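/- Let $d\ge 2$ be an integer and $S^1=\mathbb R/\mathbb Z$. For each $\delta\in(0,\frac14)$ let $U_\delta:\mathbb R\to\mathbb R$ be a $C^1$ bump function with $U_\delta(x)=1$ for $|x|\le\frac\delta2$, $U_\delta(x)=0$ for $|x|\ge\delta$, $U_\delta'\ge 0$ on $[-\delta,-\frac\delta2]$ and $U_\delta'\le 0$ on $[\frac\delta2,\delta]$. For $\varepsilon\in(0,1)$ and $\delta\in(0,\frac14)$ define $f_{\varepsilon,\delta}:S^1\to S^1$, in the coordinate $x\in[-\frac12,\frac12)$, by $$f_{\varepsilon,\delta}(x)=dx+(-d+\varepsilon)\,x\,U_\delta(x)\ \bmod 1,$$ and let $f_{0,0}(x)=E_d(x)=dx \bmod 1$. A point $x$ is non-wandering for $f$ if for every neighbourhood $V$ of $x$ there is $m\ge1$ with $f^m(V)\cap V\neq\emptyset$; $NW(f)$ is the set of such points. A $C^1$ map $f:S^1\to S^1$ is structurally stable if every $C^1$ map sufficiently $C^1$-close to $f$ is topologically conjugate to $f$. A nonsingular $d$-endomorphism is a $C^1$ map of $S^1$ onto itself of degree $d$ that has nowhere vanishing derivative and is a $d$-fold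 covering. 1. For all $\varepsilon\in(0,1)$, $\delta\in(0,\frac14)$ the map $f_{\varepsilon,\delta}$ is a nonsingular $d$-endomorphism. If moreover $U_\delta'(x)\neq0$ at every $x$ with $U_\delta(x)=\frac{d-1}{d-\varepsilon}$ (for instance, if $U_\delta'\ne0$ on $(-\delta,-\frac\delta2)\cup(\frac\delta2,\delta)$), then $f_{\varepsilon,\delta}$ is structurally stable, the point $0$ is a hyperbolic attracting fixed point of $f_{\varepsilon,\delta}$ and its only hyperbolic attracting periodic point, and $NW(f_{\varepsilon,\delta})=\{0\}\cup C$ for some Cantor set $C\subset S^1$ with $0\notin C$. 2. $f_{0,0}=E_d$ is a structurally stable nonsingular $d$-endomorphism and $NW(f_{0,0})=S^1$. 3. For every fixed $\varepsilon\in(0,1)$, $f_{\varepsilon,\delta}\to E_d$ uniformly on $S^1$ (i.e. in the $C^0$ topology) as $\delta\to0^+$. -/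

import Mathlib

open Set Filter Topology

/-- `U` is a (`C¹`) bump function of size `δ`: it equals `1` on `[-δ/2, δ/2]`, vanishes for
`|x| ≥ δ`, is nondecreasing on `[-δ, -δ/2]` and nonincreasing on `[δ/2, δ]`. -/
structure IsBump (δ : ℝ) (U : ℝ → ℝ) : Prop where
  contDiff : ContDiff ℝ 1 U
  eq_one : ∀ x ∈ Icc (-(δ / 2)) (δ / 2), U x = 1
  eq_zero : ∀ x, δ ≤ |x| → U x = 0
  deriv_nonneg : ∀ x ∈ Icc (-δ) (-(δ / 2)), 0 ≤ deriv U x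
  deriv_nonpos : ∀ x ∈ Icc (δ / 2) δ, deriv U x ≤ 0

/-- The linear expanding map `x ↦ d x mod 1` of the circle `ℝ / ℤ`. -/
def linearExpanding (d : ℕ) (x : UnitAddCircle) : UnitAddCircle := d • x

/-- The two-parameter family: `x ↦ d x + (-d + ε) x U_δ(x) mod 1`, where `x ∈ [-1/2, 1/2)` is the
coordinate on the circle, and `x ↦ d x mod 1` for `ε = δ = 0`. -/
noncomputable def bifFamily (d : ℕ) (U : ℝ → ℝ → ℝ) (ε δ : ℝ) : UnitAddCircle → UnitAddCircle :=
  open Classical in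
  if ε = 0 ∧ δ = 0 then linearExpanding d
  else AddCircle.liftIco (1 : ℝ) (-(1 / 2) : ℝ)
    (fun x : ℝ => ((d * x + (-d + ε) * x * U δ x : ℝ) : UnitAddCircle))

/-- `F : ℝ → ℝ` is a `C¹` lift of the circle map `f`. A circle map is `C¹` iff it has a `C¹` lift,
and two lifts differ by an integer, so that `F'` is the derivative of `f`. -/
def IsC1Lift (F : ℝ → ℝ) (f : UnitAddCircle → UnitAddCircle) : Prop :=
  ContDiff ℝ 1 F ∧ ∀ t : ℝ, f (t : UnitAddCircle) = (F t : UnitAddCircle)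

/-- `f` is a nonsingular `d`-endomorphism of the circle: a `C¹` map of the circle onto itself, of
degree `d`, whose derivative vanishes nowhere, and which is a `d`-fold covering. -/
def IsNonsingularEndo (d : ℕ) (f : UnitAddCircle → UnitAddCircle) : Prop :=
  (∃ F : ℝ → ℝ, IsC1Lift F f ∧ (∀ t, F (t + 1) = F t + d) ∧ ∀ t, deriv F t ≠ 0) ∧
  Function.Surjective f ∧ IsCoveringMap f ∧ ∀ y, (f ⁻¹' {y}).ncard = d

/-- `f` and `g` are `C¹` and at `C¹` distance less than `η`. -/
def C1Close (η : ℝ) (f g : UnitAddCircle → UnitAddCircle) : Prop :=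
  ∃ F G : ℝ → ℝ, IsC1Lift F f ∧ IsC1Lift G g ∧
    ∀ t, |F t - G t| < η ∧ |deriv F t - deriv G t| < η

/-- `f` is structurally stable: every `C¹` map that is sufficiently close to `f` in the `C¹`
topology is topologically conjugate to `f`. -/
def IsStructurallyStable (f : UnitAddCircle → UnitAddCircle) : Prop :=
  (∃ F, IsC1Lift F f) ∧
  ∃ η > 0, ∀ g : UnitAddCircle → UnitAddCircle, C1Close η f g →
    ∃ h : UnitAddCircle ≃ₜ UnitAddCircle, Function.Semiconj h f g

/-- The non-wandering set of `f`. -/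
def nonWandering {X : Type*} [TopologicalSpace X] (f : X → X) : Set X :=
  {x | ∀ V ∈ 𝓝 x, ∃ m : ℕ, 1 ≤ m ∧ ((f^[m]) '' V ∩ V).Nonempty}

/-- `x` is a hyperbolic attracting periodic point of `f`, of (not necessarily least) period `n`:
`fⁿ(x) = x` and `|(fⁿ)'(x)| < 1`. -/
def IsHyperbolicAttracting (f : UnitAddCircle → UnitAddCircle) (n : ℕ) (x : UnitAddCircle) : Prop :=
  0 < n ∧ f^[n] x = x ∧
    ∃ (F : ℝ → ℝ) (t : ℝ), IsC1Lift F f ∧ (t : UnitAddCircle) = x ∧ |deriv (F^[n]) t| < 1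

/-- A Cantor subset of the circle: nonempty, closed (hence compact), without isolated points,
and totally disconnected. -/
def IsCantor (C : Set UnitAddCircle) : Prop :=
  C.Nonempty ∧ Perfect C ∧ IsTotallyDisconnected C

/-! ### Lifts of circle maps -/

/-! Everything is done on lifts. Near `0` the lift satisfies `F x - x = (d - ε) x (c - U x)` with `c
= (d - 1) / (d - ε)`, and its derivative is `d - (d - ε)(U + x U')`. Since `U ≤ 1` and `x U' ≤ 0`,
the derivative is at least `ε`, which gives the covering. If `c` is a regular level, `U` crosses it
once on each side of `0`. This yields two further fixed points bounding a gap attracted to `0`, and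
off the gap `F' > 1`. `IsGapLift` records this picture.

The picture is `C¹`-open (`exists_forall_close_isGapLift`), and two gap lifts of the same degree are
conjugate (`IsGapLift.exists_conj`); together these give structural stability. For the conjugacy,
the maps are matched on the gaps through fundamental domains, the matching is extended to a map `Φ`
of the line commuting with the unit translation, and `G⁻ⁿ ∘ Φ ∘ Fⁿ` is iterated. This sequence is
stationary on the gap, and expansion of `G` makes it converge geometrically elsewhere. The same
construction with `F` and `G` exchanged produces the inverse. For `E_d` there is no gap, and `Φ =
id` suffices.

The Cantor set consists of the points whose orbits avoid the gap. An interval around such a point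
expands until some iterate covers the circle (`exists_image_eq_univ`), so the set is non-wandering,
perfect and totally disconnected. All other points enter the gap and wander, apart from the
attractor itself. A periodic orbit avoiding the gap has multiplier greater than `1`. Uniform
convergence only needs `|x U x| ≤ δ`. -/

lemma map_add_intCast {F : ℝ → ℝ} {c : ℝ} (hF : ∀ x, F (x + 1) = F x + c) (x : ℝ) (k : ℤ) :
    F (x + k) = F x + c * k := by
  induction k using Int.induction_on with
  | zero => simp
  | succ n ih =>
    have := hF (x + n)
    push_cast at ih ⊢
    rw [← add_assoc, this, ih]; ring
  | pred n ih =>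
    have := hF (x + (-n - 1))
    push_cast at ih ⊢
    rw [show x + (-(n : ℝ) - 1) + 1 = x + -n by ring, ih] at this
    linarith

lemma iterate_map_add_intCast {F : ℝ → ℝ} {d : ℕ} (hF : ∀ x, F (x + 1) = F x + d) (n : ℕ) (x : ℝ)
    (k : ℤ) : F^[n] (x + k) = F^[n] x + (d : ℝ) ^ n * k := by
  induction n generalizing x k with
  | zero => simp
  | succ n ih =>
    rw [Function.iterate_succ_apply, map_add_intCast hF, Function.iterate_succ_apply]
    have := ih (F x) (d * k)
    push_cast at this
    rw [this]; ring

lemma iterate_coe {F : ℝ → ℝ} {f : UnitAddCircle → UnitAddCircle}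
    (hf : ∀ t : ℝ, f t = (F t : UnitAddCircle)) (n : ℕ) (t : ℝ) :
    f^[n] t = (F^[n] t : UnitAddCircle) := by
  induction n generalizing t with
  | zero => simp
  | succ n ih => rw [Function.iterate_succ_apply, hf, ih, Function.iterate_succ_apply]

lemma coe_eq_coe_iff_exists_int {s t : ℝ} :
    (s : UnitAddCircle) = t ↔ ∃ k : ℤ, t = s + k := by
  rw [eq_comm, ← sub_eq_zero, ← AddCircle.coe_sub, AddCircle.coe_eq_zero_iff]
  refine exists_congr fun k => ?_
  simp only [zsmul_eq_mul, mul_one]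
  constructor <;> intro h <;> linarith

lemma coe_add_int (t : ℝ) (k : ℤ) : ((t + k : ℝ) : UnitAddCircle) = t :=
  (coe_eq_coe_iff_exists_int.2 ⟨k, rfl⟩).symm

/-- A homeomorphism of the line commuting with the unit translation descends to the circle. -/
lemma exists_circle_homeomorph (Φ : ℝ ≃ₜ ℝ) (hΦ : ∀ x, Φ (x + 1) = Φ x + 1) :
    ∃ h : UnitAddCircle ≃ₜ UnitAddCircle, ∀ t : ℝ, h t = (Φ t : UnitAddCircle) := by
  have hΨ : ∀ x, Φ.symm (x + 1) = Φ.symm x + 1 := fun x => by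
    apply Φ.injective; rw [hΦ]; simp
  have key : ∀ Θ : ℝ ≃ₜ ℝ, (∀ x, Θ (x + 1) = Θ x + 1) →
      ∃ h : UnitAddCircle → UnitAddCircle, Continuous h ∧ ∀ t : ℝ, h t = (Θ t : UnitAddCircle) := by
    intro Θ hΘ
    have hper : Function.Periodic (fun t => (Θ t : UnitAddCircle)) 1 := fun t => by
      simp only [hΘ]; exact AddCircle.coe_add_period 1 _
    refine ⟨hper.lift, ?_, fun t => rfl⟩
    exact continuous_quot_lift _ ((AddCircle.continuous_mk' 1).comp Θ.continuous)
  obtain ⟨h, hc, hh⟩ := key Φ hΦ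
  obtain ⟨h', hc', hh'⟩ := key Φ.symm hΨ
  refine ⟨⟨⟨h, h', fun x => ?_, fun x => ?_⟩, hc, hc'⟩, hh⟩
  · induction x using QuotientAddGroup.induction_on with | H t => ?_
    rw [hh, hh', Φ.symm_apply_apply]
  · induction x using QuotientAddGroup.induction_on with | H t => ?_
    rw [hh', hh, Φ.apply_symm_apply]

/-- A continuous strictly increasing map of positive degree is an order isomorphism of the line. -/
lemma exists_orderIso_of_degree {F : ℝ → ℝ} {d : ℕ} (hd : 0 < d) (hmono : StrictMono F)
    (hc : Continuous F) (hF : ∀ x, F (x + 1) = F x + d) : ∃ Φ : ℝ ≃o ℝ, ⇑Φ = F := by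
  have hsurj : Function.Surjective F := by
    intro y
    have hd' : (1 : ℝ) ≤ d := by exact_mod_cast hd
    obtain ⟨n, hn⟩ := exists_nat_ge |y - F 0|
    obtain ⟨h1, h2⟩ := abs_le.1 hn
    have e1 := map_add_intCast hF 0 n
    have e2 := map_add_intCast hF 0 (-n)
    push_cast at e1 e2
    have hn0 : (0 : ℝ) ≤ n := n.cast_nonneg
    have hnd : (n : ℝ) ≤ d * n := by nlinarith
    apply mem_range_of_exists_le_of_exists_ge hc
    · exact ⟨_, by rw [e2]; linarith⟩
    · exact ⟨_, by rw [e1]; linarith⟩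
  exact ⟨hmono.orderIsoOfSurjective F hsurj, rfl⟩

/-! ### Conjugacies as limits -/

/-- The sequence of approximate conjugacies `G⁻ⁿ ∘ Φ ∘ Fⁿ`. -/
def approxConj (F G Φ : ℝ ≃o ℝ) : ℕ → ℝ ≃o ℝ
  | 0 => Φ
  | n + 1 => (F.trans (approxConj F G Φ n)).trans G.symm

lemma approxConj_succ (F G Φ : ℝ ≃o ℝ) (n : ℕ) (x : ℝ) :
    approxConj F G Φ (n + 1) x = G.symm (approxConj F G Φ n (F x)) := rfl

lemma map_approxConj_succ (F G Φ : ℝ ≃o ℝ) (n : ℕ) (x : ℝ) :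
    G (approxConj F G Φ (n + 1) x) = approxConj F G Φ n (F x) := by
  rw [approxConj_succ, G.apply_symm_apply]

/-- Exchanging the two maps inverts each approximation, so the limits of the two sequences will be
inverse to each other; injectivity of the limit needs no separate argument. -/
lemma approxConj_symm (F G Φ : ℝ ≃o ℝ) (n : ℕ) :
    approxConj G F Φ.symm n = (approxConj F G Φ n).symm := by
  induction n with
  | zero => rfl
  | succ n ih =>
    ext x
    rw [approxConj_succ, ih]
    apply (approxConj F G Φ (n + 1)).injective
    rw [OrderIso.apply_symm_apply, approxConj_succ, OrderIso.apply_symm_apply,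
      OrderIso.apply_symm_apply, OrderIso.symm_apply_apply]

lemma symm_map_add_one {Φ : ℝ ≃o ℝ} (hΦ : ∀ x, Φ (x + 1) = Φ x + 1) (x : ℝ) :
    Φ.symm (x + 1) = Φ.symm x + 1 := by
  apply Φ.injective; rw [hΦ]; simp

/-- Equality of the degrees enters here: `F` turns a unit translation into a translation by `d`, and
`G⁻¹` turns it back. -/
lemma approxConj_add_one {F G Φ : ℝ ≃o ℝ} {d : ℕ} (hF : ∀ x, F (x + 1) = F x + d)
    (hG : ∀ x, G (x + 1) = G x + d) (hΦ : ∀ x, Φ (x + 1) = Φ x + 1) (n : ℕ) (x : ℝ) :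
    approxConj F G Φ n (x + 1) = approxConj F G Φ n x + 1 := by
  induction n generalizing x with
  | zero => exact hΦ x
  | succ n ih =>
    apply G.injective
    rw [map_approxConj_succ, hF, hG, map_approxConj_succ]
    have := map_add_intCast ih (F x) d
    simpa using this

lemma abs_sub_sub_map_zero_le {Φ : ℝ ≃o ℝ} (hΦ : ∀ x, Φ (x + 1) = Φ x + 1) (x : ℝ) :
    |Φ x - x - Φ 0| ≤ 1 := by
  have h1 : Φ ⌊x⌋ = Φ 0 + ⌊x⌋ := by
    have := map_add_intCast hΦ 0 ⌊x⌋
    simpa using this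
  have h2 : Φ (⌊x⌋ + 1) = Φ 0 + ⌊x⌋ + 1 := by rw [hΦ, h1]
  have h3 : Φ ⌊x⌋ ≤ Φ x := Φ.monotone (Int.floor_le x)
  have h4 : Φ x ≤ Φ (⌊x⌋ + 1) := Φ.monotone (Int.lt_floor_add_one x).le
  have h5 := Int.floor_le x
  have h6 := Int.lt_floor_add_one x
  rw [abs_le]
  constructor <;> linarith

/-- Applying `G` to consecutive approximations gives the previous pair evaluated at `F x`, so
expansion of `G` between them shrinks the uniform step by `κ⁻¹` each time. Only expansion along the
sequence is assumed, since `G` need not expand everywhere. -/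
lemma exists_tendsto_approxConj {F G Φ : ℝ ≃o ℝ} {d : ℕ} (hF : ∀ x, F (x + 1) = F x + d)
    (hG : ∀ x, G (x + 1) = G x + d) (hΦ : ∀ x, Φ (x + 1) = Φ x + 1) {κ : ℝ} (hκ : 1 < κ)
    (hexp : ∀ n x, κ * |approxConj F G Φ (n + 1) x - approxConj F G Φ n x| ≤
      |G (approxConj F G Φ (n + 1) x) - G (approxConj F G Φ n x)|) :
    ∃ Ψ : ℝ → ℝ, Continuous Ψ ∧
      TendstoUniformly (fun n x => approxConj F G Φ n x) Ψ atTop := by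
  have hκ0 : 0 < κ := by linarith
  obtain ⟨K, hK⟩ : ∃ K, ∀ x, |approxConj F G Φ 1 x - approxConj F G Φ 0 x| ≤ K := by
    -- Each of the two maps is within `1` of a translation, which accounts for the `2`.
    refine ⟨2 + |approxConj F G Φ 1 0 - approxConj F G Φ 0 0|, fun x => ?_⟩
    have h0 := abs_sub_sub_map_zero_le (approxConj_add_one hF hG hΦ 0) x
    have h1 := abs_sub_sub_map_zero_le (approxConj_add_one hF hG hΦ 1) x
    rw [abs_le] at h0 h1 ⊢
    have h2 := le_abs_self (approxConj F G Φ 1 0 - approxConj F G Φ 0 0)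
    have h3 := neg_abs_le (approxConj F G Φ 1 0 - approxConj F G Φ 0 0)
    constructor <;> linarith
  have hgeo : ∀ n x, |approxConj F G Φ (n + 1) x - approxConj F G Φ n x| ≤ K * (κ⁻¹) ^ n := by
    intro n
    induction n with
    | zero => intro x; simpa using hK x
    | succ n ih =>
      intro x
      have h1 := hexp (n + 1) x
      rw [map_approxConj_succ, map_approxConj_succ] at h1
      have h2 := ih (F x)
      rw [pow_succ, ← mul_assoc, ← div_eq_mul_inv, le_div_iff₀ hκ0]
      linarith
  have hinv : κ⁻¹ < 1 := inv_lt_one_of_one_lt₀ hκ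
  have hdist : ∀ x n, dist (approxConj F G Φ n x) (approxConj F G Φ (n + 1) x) ≤
      K * (κ⁻¹) ^ n := fun x n => by
    rw [dist_comm, Real.dist_eq]; exact hgeo n x
  choose Ψ hΨ using fun x =>
    cauchySeq_tendsto_of_complete (cauchySeq_of_le_geometric _ K hinv (hdist x))
  have hunif : TendstoUniformly (fun n x => approxConj F G Φ n x) Ψ atTop := by
    rw [Metric.tendstoUniformly_iff]
    intro e he
    have hlim : Tendsto (fun n : ℕ => K * (κ⁻¹) ^ n / (1 - κ⁻¹)) atTop (𝓝 0) := by
      have := tendsto_pow_atTop_nhds_zero_of_lt_one (inv_nonneg.2 hκ0.le) hinv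
      simpa using (this.const_mul K).div_const (1 - κ⁻¹)
    filter_upwards [hlim.eventually (gt_mem_nhds he)] with n hn x
    rw [dist_comm]
    exact (dist_le_of_le_geometric_of_tendsto _ _ hinv (hdist x) (hΨ x) n).trans_lt hn
  exact ⟨Ψ, hunif.continuous (Frequently.of_forall fun n => (approxConj F G Φ n).continuous), hunif⟩

/-- If the approximate conjugacies in both directions are contracted, their limit is a conjugacy. -/
lemma exists_conj_of_approxConj {F G Φ : ℝ ≃o ℝ} {d : ℕ} (hF : ∀ x, F (x + 1) = F x + d)
    (hG : ∀ x, G (x + 1) = G x + d) (hΦ : ∀ x, Φ (x + 1) = Φ x + 1) {κ κ' : ℝ} (hκ : 1 < κ)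
    (hκ' : 1 < κ')
    (hexp : ∀ n x, κ * |approxConj F G Φ (n + 1) x - approxConj F G Φ n x| ≤
      |G (approxConj F G Φ (n + 1) x) - G (approxConj F G Φ n x)|)
    (hexp' : ∀ n x, κ' * |approxConj G F Φ.symm (n + 1) x - approxConj G F Φ.symm n x| ≤
      |F (approxConj G F Φ.symm (n + 1) x) - F (approxConj G F Φ.symm n x)|) :
    ∃ Ψ : ℝ ≃ₜ ℝ, (∀ x, Ψ (x + 1) = Ψ x + 1) ∧ ∀ x, Ψ (F x) = G (Ψ x) := by
  have key : ∀ {F G Φ : ℝ ≃o ℝ} {Ψ Ψ' : ℝ → ℝ},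
      TendstoUniformly (fun n x => approxConj F G Φ n x) Ψ atTop → Continuous Ψ' →
      TendstoUniformly (fun n x => approxConj G F Φ.symm n x) Ψ' atTop → ∀ x, Ψ' (Ψ x) = x := by
    intro F G Φ Ψ Ψ' h hc h' x
    -- The argument moves with `n`, so uniform convergence of the outer sequence and continuity of
    -- its limit are both needed.
    have h1 := h'.tendsto_comp (hc.continuousAt (x := Ψ x)) (h.tendsto_at x)
    have h2 : (fun n => approxConj G F Φ.symm n (approxConj F G Φ n x)) = fun _ => x := by
      ext n; rw [approxConj_symm, OrderIso.symm_apply_apply]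
    rw [h2] at h1
    exact tendsto_nhds_unique h1 tendsto_const_nhds
  obtain ⟨Ψ, hc, hΨ⟩ := exists_tendsto_approxConj hF hG hΦ hκ hexp
  obtain ⟨Ψ', hc', hΨ'⟩ := exists_tendsto_approxConj hG hF (symm_map_add_one hΦ) hκ' hexp'
  refine ⟨⟨⟨Ψ, Ψ', key hΨ hc' hΨ', ?_⟩, hc, hc'⟩, fun x => ?_, fun x => ?_⟩
  · exact key hΨ' hc (by rwa [OrderIso.symm_symm])
  · change Ψ (x + 1) = Ψ x + 1
    have h1 := (hΨ.tendsto_at x).add_const 1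
    refine tendsto_nhds_unique (hΨ.tendsto_at (x + 1)) ?_
    simpa only [approxConj_add_one hF hG hΦ] using h1
  · change Ψ (F x) = G (Ψ x)
    have h1 := (G.continuous.tendsto _).comp ((tendsto_add_atTop_iff_nat 1).2 (hΨ.tendsto_at x))
    refine tendsto_nhds_unique (hΨ.tendsto_at (F x)) ?_
    refine h1.congr fun n => ?_
    exact map_approxConj_succ F G Φ n x

lemma exists_semiconj_of_lifts {F G : ℝ → ℝ} {f g : UnitAddCircle → UnitAddCircle}
    (hf : ∀ t : ℝ, f t = (F t : UnitAddCircle)) (hg : ∀ t : ℝ, g t = (G t : UnitAddCircle))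
    (h : ∃ Ψ : ℝ ≃ₜ ℝ, (∀ x, Ψ (x + 1) = Ψ x + 1) ∧ ∀ x, Ψ (F x) = G (Ψ x)) :
    ∃ h : UnitAddCircle ≃ₜ UnitAddCircle, Function.Semiconj h f g := by
  obtain ⟨Ψ, h1, h2⟩ := h
  obtain ⟨h, hh⟩ := exists_circle_homeomorph Ψ h1
  refine ⟨h, fun x => ?_⟩
  induction x using QuotientAddGroup.induction_on with | H t => ?_
  rw [hf, hh, hh, hg, h2]

/-- Uniformly expanding lifts of the same degree are conjugate. -/
lemma exists_conj_of_expanding {F G : ℝ ≃o ℝ} {d : ℕ} (hF : ∀ x, F (x + 1) = F x + d)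
    (hG : ∀ x, G (x + 1) = G x + d) {κ κ' : ℝ} (hκ : 1 < κ) (hκ' : 1 < κ')
    (hFe : ∀ x y, κ * |x - y| ≤ |F x - F y|) (hGe : ∀ x y, κ' * |x - y| ≤ |G x - G y|) :
    ∃ Ψ : ℝ ≃ₜ ℝ, (∀ x, Ψ (x + 1) = Ψ x + 1) ∧ ∀ x, Ψ (F x) = G (Ψ x) :=
  exists_conj_of_approxConj (Φ := OrderIso.refl ℝ) hF hG (fun _ => rfl) hκ' hκ
    (fun _ _ => hGe _ _) (fun _ _ => hFe _ _)

/-! ### Extension from a fundamental domain -/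

lemma zpow_add_one_apply (F : ℝ ≃o ℝ) (n : ℤ) (x : ℝ) : (F ^ (n + 1)) x = F ((F ^ n) x) := by
  rw [add_comm, zpow_add, zpow_one]; rfl

lemma zpow_add_one_apply' (F : ℝ ≃o ℝ) (n : ℤ) (x : ℝ) : (F ^ (n + 1)) x = (F ^ n) (F x) := by
  rw [zpow_add, zpow_one]; rfl

lemma strictMono_zpow_apply {F : ℝ ≃o ℝ} {c : ℝ} (hc : c < F c) :
    StrictMono fun n : ℤ => (F ^ n) c :=
  strictMono_int_of_lt_succ fun n => by
    rw [zpow_add_one_apply']; exact (F ^ n).strictMono hc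

/-- A parametrization of the fundamental domain `[c, F c)` extends to an equivariant one. -/
lemma exists_equivariant_extension {F : ℝ ≃o ℝ} {c : ℝ} (hc : c < F c) {γ : ℝ → ℝ}
    (hγ : StrictMonoOn γ (Ico 0 1)) (hγc : γ '' Ico 0 1 = Ico c (F c)) :
    ∃ β : ℝ → ℝ, StrictMono β ∧ (∀ s, β (s + 1) = F (β s)) ∧ EqOn β γ (Ico 0 1) ∧
      range β = {x | ∃ n : ℤ, (F ^ n) c ≤ x ∧ x < (F ^ (n + 1)) c} := by
  have hfr : ∀ s : ℝ, Int.fract s ∈ Ico (0 : ℝ) 1 := fun s => ⟨Int.fract_nonneg s, Int.fract_lt_one s⟩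
  have hmem : ∀ s : ℝ, γ (Int.fract s) ∈ Ico c (F c) := fun s => hγc ▸ mem_image_of_mem γ (hfr s)
  have hz := strictMono_zpow_apply hc
  have hlow : ∀ s : ℝ, (F ^ ⌊s⌋) c ≤ (F ^ ⌊s⌋) (γ (Int.fract s)) := fun s =>
    (F ^ ⌊s⌋).monotone (hmem s).1
  have hupp : ∀ s : ℝ, (F ^ ⌊s⌋) (γ (Int.fract s)) < (F ^ (⌊s⌋ + 1)) c := fun s => by
    rw [zpow_add_one_apply']; exact (F ^ ⌊s⌋).strictMono (hmem s).2
  refine ⟨fun s => (F ^ ⌊s⌋) (γ (Int.fract s)), ?_, ?_, ?_, ?_⟩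
  · intro s t hst
    rcases (Int.floor_mono hst.le).eq_or_lt with h | h
    · have : Int.fract s < Int.fract t := by
        rw [← Int.self_sub_floor, ← Int.self_sub_floor, h]; linarith
      simp only [h]
      exact (F ^ ⌊t⌋).strictMono (hγ (hfr s) (hfr t) this)
    · exact (hupp s).trans_le ((hz.monotone (Int.add_one_le_iff.2 h)).trans (hlow t))
  · intro s
    simp only [Int.floor_add_one, Int.fract_add_one, zpow_add_one_apply]
  · intro s hs
    simp only [Int.floor_eq_zero_iff.2 hs, Int.fract_eq_self.2 hs, zpow_zero]; rfl
  · ext x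
    constructor
    · rintro ⟨s, rfl⟩
      exact ⟨⌊s⌋, hlow s, hupp s⟩
    · rintro ⟨n, h1, h2⟩
      have hy : (F ^ n).symm x ∈ Ico c (F c) := by
        constructor
        · rwa [OrderIso.le_symm_apply]
        · rwa [OrderIso.symm_apply_lt, ← zpow_add_one_apply']
      rw [← hγc] at hy
      obtain ⟨t, ht, hty⟩ := hy
      refine ⟨n + t, ?_⟩
      simp only [Int.floor_intCast_add, Int.fract_intCast_add, Int.floor_eq_zero_iff.2 ht,
        Int.fract_eq_self.2 ht, add_zero, hty, OrderIso.apply_symm_apply]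

/-- Orbits of an increasing map without fixed points in `(a, b)` exhaust `(a, b)`. -/
lemma setOf_zpow_eq_Ioo {F : ℝ ≃o ℝ} {a b c : ℝ} (ha : F a = a) (hb : F b = b)
    (hF : ∀ x ∈ Ioo a b, x < F x) (hc : c ∈ Ioo a b) :
    {x | ∃ n : ℤ, (F ^ n) c ≤ x ∧ x < (F ^ (n + 1)) c} = Ioo a b := by
  have hz := strictMono_zpow_apply (hF c hc)
  have hfix : ∀ y, F y = y → ∀ n : ℤ, (F ^ n) y = y := by
    intro y hy n
    induction n using Int.induction_on with
    | zero => rfl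
    | succ n ih => rw [zpow_add_one_apply, ih, hy]
    | pred n ih =>
      have := zpow_add_one_apply F (-n - 1) y
      rw [sub_add_cancel, ih] at this
      apply F.injective; rw [← this, hy]
  have hmem : ∀ n : ℤ, (F ^ n) c ∈ Ioo a b := fun n => by
    constructor
    · rw [← hfix a ha n]; exact (F ^ n).strictMono hc.1
    · rw [← hfix b hb n]; exact (F ^ n).strictMono hc.2
  have hshift : ∀ n : ℤ, F ((F ^ n) c) = (F ^ ((Equiv.addRight (1 : ℤ)) n)) c := fun n =>
    (zpow_add_one_apply F n c).symm
  have hbb : BddAbove (range fun n : ℤ => (F ^ n) c) := ⟨b, by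
    rintro _ ⟨n, rfl⟩; exact (hmem n).2.le⟩
  have hba : BddBelow (range fun n : ℤ => (F ^ n) c) := ⟨a, by
    rintro _ ⟨n, rfl⟩; exact (hmem n).1.le⟩
  -- `F` only shifts the index of the orbit, so it fixes the supremum and the infimum. As there is
  -- no fixed point inside `(a, b)`, the orbit passes every point in both directions.
  have hsup : F (⨆ n : ℤ, (F ^ n) c) = ⨆ n : ℤ, (F ^ n) c := by
    rw [F.map_ciSup hbb]
    simp only [hshift]
    exact (Equiv.addRight (1 : ℤ)).iSup_comp (g := fun n : ℤ => (F ^ n) c)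
  have hinf : F (⨅ n : ℤ, (F ^ n) c) = ⨅ n : ℤ, (F ^ n) c := by
    rw [F.map_ciInf hba]
    simp only [hshift]
    exact (Equiv.addRight (1 : ℤ)).iInf_comp (g := fun n : ℤ => (F ^ n) c)
  ext x
  constructor
  · rintro ⟨n, h1, h2⟩
    exact ⟨(hmem n).1.trans_le h1, h2.trans (hmem _).2⟩
  · intro hx
    obtain ⟨m, hm⟩ : ∃ m : ℤ, x < (F ^ m) c := by
      by_contra! h
      have h1 : (⨆ n : ℤ, (F ^ n) c) ≤ x := ciSup_le h
      have h2 : (F ^ (0 : ℤ)) c ≤ ⨆ n : ℤ, (F ^ n) c := le_ciSup hbb 0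
      exact (hF _ ⟨hc.1.trans_le h2, h1.trans_lt hx.2⟩).ne' hsup
    obtain ⟨l, hl⟩ : ∃ l : ℤ, (F ^ l) c ≤ x := by
      by_contra! h
      have h1 : x ≤ ⨅ n : ℤ, (F ^ n) c := le_ciInf fun n => (h n).le
      have h2 : (⨅ n : ℤ, (F ^ n) c) ≤ (F ^ (0 : ℤ)) c := ciInf_le hba 0
      exact (hF _ ⟨hx.1.trans_le h1, h2.trans_lt hc.2⟩).ne' hinf
    obtain ⟨n, hn, hn'⟩ := Int.exists_greatest_of_bdd (P := fun n : ℤ => (F ^ n) c ≤ x)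
      ⟨m, fun z hz' => (hz.lt_iff_lt.1 (hz'.trans_lt hm)).le⟩ ⟨l, hl⟩
    refine ⟨n, hn, ?_⟩
    by_contra! h
    have := hn' _ h
    omega

/-! ### Increasing bijections between intervals -/

/-- `ψ` restricts to an increasing bijection from `[a, b]` onto `[a', b']`. -/
structure IsIncBij (ψ : ℝ → ℝ) (a b a' b' : ℝ) : Prop where
  strictMonoOn : StrictMonoOn ψ (Icc a b)
  left : ψ a = a'
  right : ψ b = b'
  surjOn : SurjOn ψ (Icc a b) (Icc a' b')

lemma IsIncBij.mapsTo {ψ : ℝ → ℝ} {a b a' b' : ℝ} (h : IsIncBij ψ a b a' b') :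
    MapsTo ψ (Icc a b) (Icc a' b') := fun x hx => by
  have hab := hx.1.trans hx.2
  rw [← h.left, ← h.right]
  exact ⟨h.strictMonoOn.monotoneOn ⟨le_rfl, hab⟩ hx hx.1,
    h.strictMonoOn.monotoneOn hx ⟨hab, le_rfl⟩ hx.2⟩

lemma IsIncBij.glue {ψ₁ ψ₂ : ℝ → ℝ} {a b c a' b' c' : ℝ} (h₁ : IsIncBij ψ₁ a b a' b')
    (h₂ : IsIncBij ψ₂ b c b' c') (hab : a ≤ b) (hbc : b ≤ c) :
    ∃ ψ, IsIncBij ψ a c a' c' ∧ EqOn ψ ψ₁ (Icc a b) ∧ EqOn ψ ψ₂ (Icc b c) := by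
  set ψ : ℝ → ℝ := fun x => if x ≤ b then ψ₁ x else ψ₂ x with hψ
  have e₁ : EqOn ψ ψ₁ (Icc a b) := fun x hx => if_pos hx.2
  have e₂ : EqOn ψ ψ₂ (Icc b c) := fun x hx => by
    rcases hx.1.eq_or_lt with rfl | h
    · rw [hψ]; simp only [le_refl, if_true]; rw [h₁.right, h₂.left]
    · exact if_neg h.not_ge
  refine ⟨ψ, ⟨?_, ?_, ?_, ?_⟩, e₁, e₂⟩
  · have := (h₁.strictMonoOn.congr e₁.symm).union (h₂.strictMonoOn.congr e₂.symm)
      (isGreatest_Icc hab) (isLeast_Icc hbc)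
    rwa [Icc_union_Icc_eq_Icc hab hbc] at this
  · rw [e₁ ⟨le_rfl, hab⟩, h₁.left]
  · rw [e₂ ⟨hbc, le_rfl⟩, h₂.right]
  · intro y hy
    rcases le_total y b' with h | h
    · obtain ⟨x, hx, rfl⟩ := h₁.surjOn ⟨hy.1, h⟩
      exact ⟨x, ⟨hx.1, hx.2.trans hbc⟩, e₁ hx⟩
    · obtain ⟨x, hx, rfl⟩ := h₂.surjOn ⟨h, hy.2⟩
      exact ⟨x, ⟨hab.trans hx.1, hx.2⟩, e₂ hx⟩

lemma exists_isIncBij_affine {a b a' b' : ℝ} (h : a < b) (h' : a' < b') :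
    ∃ ψ, IsIncBij ψ a b a' b' := by
  have hs : 0 < (b' - a') / (b - a) := div_pos (sub_pos.2 h') (sub_pos.2 h)
  have hba : b - a ≠ 0 := (sub_pos.2 h).ne'
  have hba' : b' - a' ≠ 0 := (sub_pos.2 h').ne'
  have e : a' + (b' - a') / (b - a) * (b - a) = b' := by field_simp; ring
  refine ⟨fun x => a' + (b' - a') / (b - a) * (x - a), fun x _ y _ hxy => ?_, by simp, e, ?_⟩
  · have := mul_lt_mul_of_pos_left (sub_lt_sub_right hxy a) hs
    simpa using this
  · have hc : ContinuousOn (fun x => a' + (b' - a') / (b - a) * (x - a)) (Icc a b) := by fun_prop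
    have := intermediate_value_Icc h.le hc
    simp only [sub_self, mul_zero, add_zero, e] at this
    exact this

/-- An increasing parametrization of an interval without interior fixed points in which the map
becomes the unit translation. -/
lemma exists_translation_coordinate {F : ℝ ≃o ℝ} {a b : ℝ} (hab : a < b) (ha : F a = a)
    (hb : F b = b) (hF : ∀ x ∈ Ioo a b, x < F x) :
    ∃ β : ℝ → ℝ, StrictMono β ∧ (∀ s, β (s + 1) = F (β s)) ∧ range β = Ioo a b := by
  obtain ⟨c, hc⟩ := exists_between hab
  have hcF := hF c hc
  obtain ⟨γ, hγ⟩ := exists_isIncBij_affine (zero_lt_one' ℝ) hcF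
  have himg : γ '' Ico 0 1 = Ico c (F c) := by
    ext y
    constructor
    · rintro ⟨x, hx, rfl⟩
      refine ⟨(hγ.mapsTo ⟨hx.1, hx.2.le⟩).1, ?_⟩
      rw [← hγ.right]
      exact hγ.strictMonoOn ⟨hx.1, hx.2.le⟩ ⟨zero_le_one, le_rfl⟩ hx.2
    · intro hy
      obtain ⟨x, hx, rfl⟩ := hγ.surjOn ⟨hy.1, hy.2.le⟩
      refine ⟨x, ⟨hx.1, hx.2.lt_of_ne ?_⟩, rfl⟩
      rintro rfl
      exact hy.2.ne hγ.right
  obtain ⟨β, h1, h2, -, h3⟩ := exists_equivariant_extension hcF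
    (hγ.strictMonoOn.mono Ico_subset_Icc_self) himg
  exact ⟨β, h1, h2, h3.trans (setOf_zpow_eq_Ioo ha hb hF hc)⟩

/-- Two increasing maps without fixed points inside an interval are conjugate there. -/
lemma exists_isIncBij_conj {F G : ℝ ≃o ℝ} {a b a' b' : ℝ} (hab : a < b) (hab' : a' < b')
    (ha : F a = a) (hb : F b = b) (ha' : G a' = a') (hb' : G b' = b')
    (hF : ∀ x ∈ Ioo a b, x < F x) (hG : ∀ x ∈ Ioo a' b', x < G x) :
    ∃ ψ, IsIncBij ψ a b a' b' ∧ ∀ x ∈ Icc a b, ψ (F x) = G (ψ x) := by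
  obtain ⟨β, hβ, hβ1, hβr⟩ := exists_translation_coordinate hab ha hb hF
  obtain ⟨β', hβ', hβ1', hβr'⟩ := exists_translation_coordinate hab' ha' hb' hG
  have hmem : ∀ s, β s ∈ Ioo a b := fun s => hβr ▸ mem_range_self s
  have hmem' : ∀ s, β' s ∈ Ioo a' b' := fun s => hβr' ▸ mem_range_self s
  -- In the coordinates `β` and `β'` both maps are the unit shift, so identifying the coordinates
  -- conjugates them; the endpoints are added by hand.
  set ψ : ℝ → ℝ := fun x => if x ≤ a then a' else if b ≤ x then b' else
    β' (Function.invFun β x) with hψ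
  have e1 : ψ a = a' := if_pos le_rfl
  have e2 : ψ b = b' := by simp only [hψ, if_neg hab.not_ge, le_refl, if_true]
  have e3 : ∀ s, ψ (β s) = β' s := fun s => by
    simp only [hψ, if_neg (hmem s).1.not_ge, if_neg (hmem s).2.not_ge,
      Function.leftInverse_invFun hβ.injective s]
  have hcases : ∀ x ∈ Icc a b, x = a ∨ x = b ∨ ∃ s, x = β s := by
    intro x hx
    rcases hx.1.eq_or_lt with h | h
    · exact Or.inl h.symm
    rcases hx.2.eq_or_lt with h' | h'
    · exact Or.inr (Or.inl h')
    · obtain ⟨s, hs⟩ : x ∈ range β := hβr ▸ ⟨h, h'⟩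
      exact Or.inr (Or.inr ⟨s, hs.symm⟩)
  refine ⟨ψ, ⟨?_, e1, e2, ?_⟩, ?_⟩
  · intro x hx y hy hxy
    rcases hcases x hx with rfl | rfl | ⟨s, rfl⟩ <;> rcases hcases y hy with rfl | rfl | ⟨t, rfl⟩
    · exact absurd hxy (lt_irrefl _)
    · rwa [e1, e2]
    · rw [e1, e3]; exact (hmem' t).1
    · exact absurd hxy hy.2.not_gt
    · exact absurd hxy (lt_irrefl _)
    · exact absurd hxy hy.2.not_gt
    · exact absurd hxy hx.1.not_gt
    · rw [e2, e3]; exact (hmem' s).2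
    · rw [e3, e3]; exact hβ' (hβ.lt_iff_lt.1 hxy)
  · intro y hy
    rcases hy.1.eq_or_lt with rfl | h
    · exact ⟨a, ⟨le_rfl, hab.le⟩, e1⟩
    rcases hy.2.eq_or_lt with rfl | h'
    · exact ⟨b, ⟨hab.le, le_rfl⟩, e2⟩
    · obtain ⟨s, rfl⟩ : y ∈ range β' := hβr' ▸ ⟨h, h'⟩
      exact ⟨β s, Ioo_subset_Icc_self (hmem s), e3 s⟩
  · intro x hx
    rcases hcases x hx with rfl | rfl | ⟨s, rfl⟩
    · rw [ha, e1, ha']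
    · rw [hb, e2, hb']
    · rw [← hβ1, e3, e3, hβ1']

lemma zpow_addRight_one_apply (n : ℤ) (x : ℝ) : ((OrderIso.addRight (1 : ℝ)) ^ n) x = x + n := by
  induction n using Int.induction_on with
  | zero => rw [zpow_zero]; simp
  | succ n ih => rw [zpow_add_one_apply, ih]; simp [add_assoc]
  | pred n ih =>
    have := zpow_add_one_apply (OrderIso.addRight (1 : ℝ)) (-n - 1) x
    rw [sub_add_cancel, ih] at this
    simp only [OrderIso.addRight_apply] at this
    push_cast at this ⊢
    linarith

/-- This is `exists_equivariant_extension` for the unit translation, whose fundamental domain is one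
period. -/
lemma IsIncBij.exists_extension {ψ : ℝ → ℝ} {p p' : ℝ} (h : IsIncBij ψ p (p + 1) p' (p' + 1)) :
    ∃ Φ : ℝ ≃o ℝ, (∀ x, Φ (x + 1) = Φ x + 1) ∧ EqOn Φ ψ (Icc p (p + 1)) := by
  have hmem : ∀ {s : ℝ}, s ∈ Ico (0 : ℝ) 1 → p + s ∈ Icc p (p + 1) := fun hs =>
    ⟨by linarith [hs.1], by linarith [hs.2]⟩
  obtain ⟨β, h1, h2, h3, h4⟩ := exists_equivariant_extension (F := OrderIso.addRight (1 : ℝ))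
    (c := p') (γ := fun s => ψ (p + s)) (by simp)
    (fun s hs t ht hst => h.strictMonoOn (hmem hs) (hmem ht) (by linarith)) (by
      ext y
      constructor
      · rintro ⟨x, hx, rfl⟩
        refine ⟨(h.mapsTo (hmem hx)).1, ?_⟩
        have := h.strictMonoOn (hmem hx) ⟨by linarith, le_rfl⟩ (by linarith [hx.2])
        rwa [h.right] at this
      · intro hy
        obtain ⟨x, hx, rfl⟩ := h.surjOn ⟨hy.1, hy.2.le⟩
        refine ⟨x - p, ⟨by linarith [hx.1], ?_⟩, by simp⟩
        rcases hx.2.eq_or_lt with rfl | hlt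
        · exact absurd h.right hy.2.ne
        · linarith)
  have hsurj : Function.Surjective fun x => β (x - p) := by
    intro y
    have hy : y ∈ range β := by
      rw [h4]
      refine ⟨⌊y - p'⌋, ?_, ?_⟩ <;> rw [zpow_addRight_one_apply]
      · linarith [Int.floor_le (y - p')]
      · push_cast; linarith [Int.lt_floor_add_one (y - p')]
    obtain ⟨s, rfl⟩ := hy
    exact ⟨s + p, by simp⟩
  have hmono : StrictMono fun x => β (x - p) := fun x y hxy => h1 (by linarith)
  have hdeg : ∀ x, β (x + 1 - p) = β (x - p) + 1 := fun x => by
    rw [show x + 1 - p = x - p + 1 by ring, h2]; rfl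
  refine ⟨hmono.orderIsoOfSurjective _ hsurj, hdeg, fun x hx => ?_⟩
  change β (x - p) = ψ x
  rcases hx.2.eq_or_lt with rfl | hlt
  · have h0 := h3 (show (0 : ℝ) ∈ Ico (0 : ℝ) 1 by simp)
    simp only [add_zero, h.left] at h0
    rw [hdeg, sub_self, h0, h.right]
  · have := h3 (show x - p ∈ Ico (0 : ℝ) 1 from ⟨by linarith [hx.1], by linarith⟩)
    simpa using this

/-! ### Lifts with one attracting gap -/

/-- A `C¹` lift of degree `d` with fixed points `p < q < r < p + 1`, for which `q` attracts
`(p, r)` and which is expanding on `[r, p + 1]`. -/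
structure IsGapLift (d : ℕ) (κ p q r : ℝ) (F : ℝ → ℝ) : Prop where
  lt_pq : p < q
  lt_qr : q < r
  lt_rp : r < p + 1
  one_lt : 1 < κ
  contDiff : ContDiff ℝ 1 F
  strictMono : StrictMono F
  map_add_one : ∀ x, F (x + 1) = F x + d
  map_p : F p = p
  map_q : F q = q
  map_r : F r = r
  lt_map : ∀ x ∈ Ioo p q, x < F x
  map_lt : ∀ x ∈ Ioo q r, F x < x
  le_deriv : ∀ x ∈ Icc r (p + 1), κ ≤ deriv F x

namespace IsGapLift

variable {d : ℕ} {κ p q r κ' p' q' r' : ℝ}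

lemma expand {F : ℝ → ℝ} (h : IsGapLift d κ p q r F) {x y : ℝ} (hx : x ∈ Icc r (p + 1))
    (hy : y ∈ Icc r (p + 1)) (hxy : x ≤ y) : κ * (y - x) ≤ F y - F x :=
  (convex_Icc r (p + 1)).mul_sub_le_image_sub_of_le_deriv h.contDiff.continuous.continuousOn
    (h.contDiff.differentiable one_ne_zero).differentiableOn
    (fun z hz => h.le_deriv z (interior_subset hz)) x hx y hy hxy

lemma abs_expand {F : ℝ → ℝ} (h : IsGapLift d κ p q r F) {x y : ℝ} (hx : x ∈ Icc r (p + 1))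
    (hy : y ∈ Icc r (p + 1)) : κ * |x - y| ≤ |F x - F y| := by
  rcases le_total x y with hxy | hxy
  · rw [abs_sub_comm, abs_sub_comm (F x), abs_of_nonneg (sub_nonneg.2 hxy)]
    exact (h.expand hx hy hxy).trans (le_abs_self _)
  · rw [abs_of_nonneg (sub_nonneg.2 hxy)]
    exact (h.expand hy hx hxy).trans (le_abs_self _)

lemma map_mem_Icc {F : ℝ → ℝ} (h : IsGapLift d κ p q r F) {x : ℝ} (hx : x ∈ Icc p r) :
    F x ∈ Icc p r :=
  ⟨h.map_p ▸ h.strictMono.monotone hx.1, h.map_r ▸ h.strictMono.monotone hx.2⟩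

/-- On `[p, r]` the map `Φ` is already a conjugacy, so the approximations never change. Over `[r, p
+ 1]` all of them take values in `[r', p' + 1]`, where `G` expands. -/
lemma approxConj_contract {F G Φ : ℝ ≃o ℝ} (hF : IsGapLift d κ p q r F)
    (hG : IsGapLift d κ' p' q' r' G) (hΦ : ∀ x, Φ (x + 1) = Φ x + 1) (hp : Φ p = p')
    (hr : Φ r = r') (hconj : ∀ x ∈ Icc p r, Φ (F x) = G (Φ x)) (n : ℕ) (x : ℝ) :
    κ' * |approxConj F G Φ (n + 1) x - approxConj F G Φ n x| ≤
      |G (approxConj F G Φ (n + 1) x) - G (approxConj F G Φ n x)| := by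
  have hgap : ∀ n, ∀ x ∈ Icc p r, approxConj F G Φ n x = Φ x := by
    intro n
    induction n with
    | zero => intro x _; rfl
    | succ n ih =>
      intro x hx
      rw [approxConj_succ, ih _ (hF.map_mem_Icc hx), hconj x hx, G.symm_apply_apply]
  have hpr := hF.lt_pq.trans hF.lt_qr
  have hadd := approxConj_add_one hF.map_add_one hG.map_add_one hΦ
  have hmem : ∀ n, ∀ x ∈ Icc r (p + 1), approxConj F G Φ n x ∈ Icc r' (p' + 1) := by
    intro n x hx
    have h1 := (approxConj F G Φ n).monotone hx.1
    have h2 := (approxConj F G Φ n).monotone hx.2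
    rw [hadd, hgap n p ⟨le_rfl, hpr.le⟩, hp] at h2
    rw [hgap n r ⟨hpr.le, le_rfl⟩, hr] at h1
    exact ⟨h1, h2⟩
  have base : ∀ x ∈ Icc p (p + 1),
      κ' * |approxConj F G Φ (n + 1) x - approxConj F G Φ n x| ≤
      |G (approxConj F G Φ (n + 1) x) - G (approxConj F G Φ n x)| := by
    intro x hx
    rcases le_total x r with h | h
    · rw [hgap _ x ⟨hx.1, h⟩, hgap _ x ⟨hx.1, h⟩]; simp
    · exact hG.abs_expand (hmem _ x ⟨h, hx.2⟩) (hmem _ x ⟨h, hx.2⟩)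
  -- A translation by an integer changes both sides by the same amount, so one period suffices.
  have hx := base (x - ⌊x - p⌋)
    ⟨by linarith [Int.floor_le (x - p)], by linarith [Int.lt_floor_add_one (x - p)]⟩
  have e : ∀ m, approxConj F G Φ m (x - ⌊x - p⌋) = approxConj F G Φ m x + (-⌊x - p⌋ : ℤ) := by
    intro m
    have := map_add_intCast (hadd m) x (-⌊x - p⌋)
    push_cast at this ⊢
    rw [sub_eq_add_neg, this]; ring
  rwa [e, e, map_add_intCast hG.map_add_one, map_add_intCast hG.map_add_one,
    add_sub_add_right_eq_sub, add_sub_add_right_eq_sub] at hx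

/-- Two gap lifts of the same degree are conjugate. -/
lemma exists_conj {F G : ℝ ≃o ℝ} (hF : IsGapLift d κ p q r F) (hG : IsGapLift d κ' p' q' r' G) :
    ∃ Ψ : ℝ ≃ₜ ℝ, (∀ x, Ψ (x + 1) = Ψ x + 1) ∧ ∀ x, Ψ (F x) = G (Ψ x) := by
  obtain ⟨ψ₁, h₁, hc₁⟩ := exists_isIncBij_conj hF.lt_pq hG.lt_pq hF.map_p hF.map_q hG.map_p
    hG.map_q hF.lt_map hG.lt_map
  have hsymm : ∀ {H : ℝ ≃o ℝ} {x : ℝ}, H x = x → H.symm x = x := fun {H x} h => by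
    rw [OrderIso.symm_apply_eq, h]
  have hsymm_lt : ∀ {H : ℝ ≃o ℝ} {a b : ℝ}, (∀ x ∈ Ioo a b, H x < x) →
      ∀ x ∈ Ioo a b, x < H.symm x := by
    intro H a b h x hx
    rw [OrderIso.lt_symm_apply]
    exact h x hx
  -- On `(q, r)` points move to the left; the inverses move them to the right, as the conjugation
  -- lemma requires.
  obtain ⟨ψ₂, h₂, hc₂⟩ := exists_isIncBij_conj (F := F.symm) (G := G.symm) hF.lt_qr hG.lt_qr
    (hsymm hF.map_q) (hsymm hF.map_r) (hsymm hG.map_q) (hsymm hG.map_r)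
    (hsymm_lt hF.map_lt) (hsymm_lt hG.map_lt)
  -- Outside the gap any increasing bijection will do, since the limit corrects it.
  obtain ⟨ψ₃, h₃⟩ := exists_isIncBij_affine hF.lt_rp hG.lt_rp
  have hpr := hF.lt_pq.le.trans hF.lt_qr.le
  obtain ⟨ψ₄, h₄, e₁, e₂⟩ := h₁.glue h₂ hF.lt_pq.le hF.lt_qr.le
  obtain ⟨ψ, h, e₄, -⟩ := h₄.glue h₃ hpr hF.lt_rp.le
  obtain ⟨Φ, hΦ, e⟩ := h.exists_extension
  have hΦ₄ : ∀ x ∈ Icc p r, Φ x = ψ₄ x := fun x hx => by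
    rw [e ⟨hx.1, hx.2.trans hF.lt_rp.le⟩, e₄ hx]
  have hp : Φ p = p' := by rw [hΦ₄ p ⟨le_rfl, hpr⟩, h₄.left]
  have hr : Φ r = r' := by rw [hΦ₄ r ⟨hpr, le_rfl⟩, h₄.right]
  have hconj : ∀ x ∈ Icc p r, Φ (F x) = G (Φ x) := by
    intro x hx
    rw [hΦ₄ x hx, hΦ₄ _ (hF.map_mem_Icc hx)]
    rcases le_total x q with hxq | hxq
    · have hFx : F x ∈ Icc p q :=
        ⟨(hF.map_mem_Icc hx).1, hF.map_q ▸ F.monotone hxq⟩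
      rw [e₁ hFx, e₁ ⟨hx.1, hxq⟩, hc₁ x ⟨hx.1, hxq⟩]
    · have hFx : F x ∈ Icc q r :=
        ⟨hF.map_q ▸ F.monotone hxq, (hF.map_mem_Icc hx).2⟩
      rw [e₂ hFx, e₂ ⟨hxq, hx.2⟩]
      have := hc₂ (F x) hFx
      rw [F.symm_apply_apply] at this
      rw [this, G.apply_symm_apply]
  refine exists_conj_of_approxConj hF.map_add_one hG.map_add_one hΦ hG.one_lt hF.one_lt
    (hF.approxConj_contract hG hΦ hp hr hconj)
    (hG.approxConj_contract hF (symm_map_add_one hΦ) ?_ ?_ fun y hy => ?_)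
  · rw [OrderIso.symm_apply_eq, hp]
  · rw [OrderIso.symm_apply_eq, hr]
  · have hx : Φ.symm y ∈ Icc p r :=
      ⟨by rw [OrderIso.le_symm_apply, hp]; exact hy.1, by rw [OrderIso.symm_apply_le, hr]; exact hy.2⟩
    rw [OrderIso.symm_apply_eq, hconj _ hx, Φ.apply_symm_apply]

end IsGapLift

/-! ### Robustness of gap lifts -/

lemma deriv_add_one {F : ℝ → ℝ} {c : ℝ} (hF : ∀ x, F (x + 1) = F x + c) (x : ℝ) :
    deriv F (x + 1) = deriv F x := by
  rw [← deriv_comp_add_const, funext hF, deriv_add_const]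

/-- Once a fixed point is known, monotonicity of the displacement decides on which side points move
left or right. -/
lemma strictMonoOn_sub_id {G : ℝ → ℝ} (hG : ContDiff ℝ 1 G) {a b : ℝ}
    (h : ∀ x ∈ Icc a b, 1 < deriv G x) : StrictMonoOn (fun x => G x - x) (Icc a b) := by
  have hd := hG.differentiable one_ne_zero
  refine strictMonoOn_of_deriv_pos (convex_Icc a b)
    (hG.continuous.sub continuous_id).continuousOn fun x hx => ?_
  have : deriv (fun x => G x - x) x = deriv G x - 1 :=
    ((hd x).hasDerivAt.sub (hasDerivAt_id x)).deriv
  rw [this]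
  linarith [h x (interior_subset hx)]

lemma strictAntiOn_sub_id {G : ℝ → ℝ} (hG : ContDiff ℝ 1 G) {a b : ℝ}
    (h : ∀ x ∈ Icc a b, deriv G x < 1) : StrictAntiOn (fun x => G x - x) (Icc a b) := by
  have hd := hG.differentiable one_ne_zero
  refine strictAntiOn_of_deriv_neg (convex_Icc a b)
    (hG.continuous.sub continuous_id).continuousOn fun x hx => ?_
  have : deriv (fun x => G x - x) x = deriv G x - 1 :=
    ((hd x).hasDerivAt.sub (hasDerivAt_id x)).deriv
  rw [this]
  linarith [h x (interior_subset hx)]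

/-- Every degree `d` map that is `C¹`-close to a map with one hyperbolic attracting gap is a gap
lift. -/
lemma exists_forall_close_isGapLift {F : ℝ → ℝ} {d : ℕ} {p a q b r : ℝ} (hF : ContDiff ℝ 1 F)
    (hdeg : ∀ x, F (x + 1) = F x + d) (hpos : ∀ x, 0 < deriv F x)
    (hpa : p < a) (haq : a < q) (hqb : q < b) (hbr : b < r) (hrp : r < p + 1)
    (hp : F p = p) (hr : F r = r)
    (hin : ∀ x ∈ Icc a b, deriv F x < 1) (hout : ∀ x ∈ Icc r (p + 1), 1 < deriv F x)
    (hlt : ∀ x ∈ Ioo p q, x < F x) (hgt : ∀ x ∈ Ioo q r, F x < x) :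
    ∃ η > 0, ∀ G : ℝ → ℝ, ContDiff ℝ 1 G → (∀ x, G (x + 1) = G x + d) →
      (∀ t, |F t - G t| < η ∧ |deriv F t - deriv G t| < η) →
      ∃ κ p' q' r', q' ∈ Icc a b ∧ IsGapLift d κ p' q' r' G := by
  have hF' : Continuous (deriv F) := hF.continuous_deriv le_rfl
  -- `ρ` is the room in which the endpoints of the gap may move: expansion persists that far beyond
  -- `[r, p + 1]`, and the `ρ`-neighbourhoods stay clear of `[a, b]` and of each other.
  obtain ⟨ρ, hρ, hρa, hρb, hρr, hρout⟩ : ∃ ρ > 0, p + ρ < a ∧ b < r - ρ ∧ r + ρ < p + 1 - ρ ∧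
      ∀ x ∈ Icc (r - ρ) (p + 1 + ρ), 1 < deriv F x := by
    have ho : IsOpen {x | 1 < deriv F x} := isOpen_lt continuous_const hF'
    obtain ⟨ρ₁, hρ₁, h₁⟩ := isCompact_Icc.exists_thickening_subset_open ho hout
    have hmin : 0 < min (min ρ₁ (a - p)) (min (r - b) ((p + 1 - r) / 2)) := by
      refine lt_min (lt_min hρ₁ ?_) (lt_min ?_ ?_) <;> linarith
    obtain ⟨ρ, h0, hρm⟩ := exists_between hmin
    simp only [lt_min_iff] at hρm
    obtain ⟨⟨k1, k2⟩, k3, k4⟩ := hρm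
    refine ⟨ρ, h0, by linarith, by linarith, by linarith, fun x hx => h₁ ?_⟩
    rw [Metric.mem_thickening_iff]
    rcases le_total x r with h | h
    · refine ⟨r, ⟨le_rfl, hrp.le⟩, ?_⟩
      rw [Real.dist_eq, abs_lt]; constructor <;> linarith [hx.1]
    rcases le_total x (p + 1) with h' | h'
    · exact ⟨x, ⟨h, h'⟩, by rw [dist_self]; exact hρ₁⟩
    · refine ⟨p + 1, ⟨hrp.le, le_rfl⟩, ?_⟩
      rw [Real.dist_eq, abs_lt]; constructor <;> linarith [hx.2]
  have hφ : Continuous fun x => F x - x := hF.continuous.sub continuous_id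
  obtain ⟨m₀, hm₀, H₀⟩ := (isCompact_Icc (a := (0 : ℝ)) (b := 1)).exists_forall_le'
    hF'.continuousOn (fun x _ => hpos x)
  obtain ⟨m₁, hm₁, H₁⟩ := (isCompact_Icc (a := a) (b := b)).exists_forall_le'
    (f := fun x => 1 - deriv F x) (continuous_const.sub hF').continuousOn (fun x hx => sub_pos.2 (hin x hx))
  obtain ⟨m₂, hm₂, H₂⟩ := (isCompact_Icc (a := r - ρ) (b := p + 1 + ρ)).exists_forall_le'
    hF'.continuousOn hρout
  obtain ⟨m₃, hm₃, H₃⟩ := (isCompact_Icc (a := b) (b := r - ρ)).exists_forall_le' (a := 0)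
    (f := fun x => x - F x) (continuous_id.sub hF.continuous).continuousOn (fun x hx => by
      have := hgt x ⟨by linarith [hx.1], by linarith [hx.2]⟩
      linarith)
  obtain ⟨m₄, hm₄, H₄⟩ := (isCompact_Icc (a := p + ρ) (b := a)).exists_forall_le' (a := 0)
    hφ.continuousOn (fun x hx => by
      have := hlt x ⟨by linarith [hx.1], by linarith [hx.2]⟩
      linarith)
  have hFmono := strictMonoOn_sub_id hF hρout
  -- The displacements at `r + ρ` and `p - ρ` supply the outer sign changes from which the perturbed
  -- endpoints are found.
  have hm₅ : 0 < F (r + ρ) - (r + ρ) := by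
    have := hFmono (a := r) ⟨by linarith, by linarith⟩ (b := r + ρ) ⟨by linarith, by linarith⟩
      (by linarith)
    simp only [hr] at this
    linarith
  have hm₆ : 0 < (p - ρ) - F (p - ρ) := by
    have := hFmono (a := p + 1 - ρ) ⟨by linarith, by linarith⟩ (b := p + 1)
      ⟨by linarith, by linarith⟩ (by linarith)
    have e := hdeg (p - ρ)
    rw [show p - ρ + 1 = p + 1 - ρ by ring] at e
    simp only [hdeg, hp, e] at this
    linarith
  -- Giving up only half of the excess `m₂ - 1` leaves the perturbed map the uniform rate `(m₂ + 1)
  -- / 2 > 1`.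
  refine ⟨min (min (min m₀ m₁) (min ((m₂ - 1) / 2) m₃))
    (min m₄ (min (F (r + ρ) - (r + ρ)) ((p - ρ) - F (p - ρ)))), ?_, fun G hG hGdeg hclose => ?_⟩
  · refine lt_min (lt_min (lt_min hm₀ hm₁) (lt_min ?_ hm₃)) (lt_min hm₄ (lt_min hm₅ hm₆))
    linarith
  simp only [lt_min_iff, abs_lt] at hclose
  have hG' : ∀ x, 0 < deriv G x := by
    intro x
    have hper : deriv F (Int.fract x) = deriv F x := by
      have h1 : ∀ y, deriv F (y + 1) = deriv F y + 0 := fun y => by rw [deriv_add_one hdeg, add_zero]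
      have h2 := map_add_intCast h1 (Int.fract x) ⌊x⌋
      rw [Int.fract_add_floor] at h2
      rw [h2]; ring
    have := H₀ _ ⟨Int.fract_nonneg x, (Int.fract_lt_one x).le⟩
    rw [hper] at this
    obtain ⟨-, ⟨⟨⟨h, -⟩, -⟩, -⟩⟩ := hclose x
    linarith [h.2]
  have hGin : ∀ x ∈ Icc a b, deriv G x < 1 := fun x hx => by
    obtain ⟨-, ⟨⟨⟨-, h⟩, -⟩, -⟩⟩ := hclose x
    have := H₁ x hx
    linarith [h.1]
  have hGout : ∀ x ∈ Icc (r - ρ) (p + 1 + ρ), (m₂ + 1) / 2 ≤ deriv G x := fun x hx => by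
    obtain ⟨-, ⟨⟨-, h, -⟩, -⟩⟩ := hclose x
    have := H₂ x hx
    linarith [h.2]
  have hκ : 1 < (m₂ + 1) / 2 := by linarith
  have hGmono := strictMonoOn_sub_id hG fun x hx => hκ.trans_le (hGout x hx)
  have hGanti := strictAntiOn_sub_id hG hGin
  have hGmono' : StrictMonoOn (fun x => G x - x) (Icc (p - ρ) (p + ρ)) := by
    refine strictMonoOn_sub_id hG fun x hx => ?_
    rw [← deriv_add_one hGdeg]
    exact hκ.trans_le (hGout _ ⟨by linarith [hx.1], by linarith [hx.2]⟩)
  have hGneg : ∀ x ∈ Icc b (r - ρ), G x < x := fun x hx => by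
    obtain ⟨⟨⟨-, -, h⟩, -⟩, -⟩ := hclose x
    have := H₃ x hx
    linarith [h.1]
  have hGpos : ∀ x ∈ Icc (p + ρ) a, x < G x := fun x hx => by
    obtain ⟨⟨-, h, -⟩, -⟩ := hclose x
    have := H₄ x hx
    linarith [h.2]
  have hGr : r + ρ < G (r + ρ) := by
    obtain ⟨⟨-, -, h, -⟩, -⟩ := hclose (r + ρ)
    linarith [h.2]
  have hGp : G (p - ρ) < p - ρ := by
    obtain ⟨⟨-, -, -, h⟩, -⟩ := hclose (p - ρ)
    linarith [h.1]
  have hψ : Continuous fun x => G x - x := hG.continuous.sub continuous_id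
  have hGa := hGpos a ⟨hρa.le, le_rfl⟩
  have hGb := hGneg b ⟨le_rfl, hρb.le⟩
  have hGpρ := hGpos (p + ρ) ⟨le_rfl, hρa.le⟩
  have hGrρ := hGneg (r - ρ) ⟨hρb.le, le_rfl⟩
  obtain ⟨q', hq', eq'⟩ : (0 : ℝ) ∈ (fun x => G x - x) '' Icc a b :=
    intermediate_value_Icc' (haq.trans hqb).le hψ.continuousOn ⟨by linarith, by linarith⟩
  obtain ⟨r', hr', er'⟩ : (0 : ℝ) ∈ (fun x => G x - x) '' Icc (r - ρ) (r + ρ) :=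
    intermediate_value_Icc (by linarith) hψ.continuousOn ⟨by linarith, by linarith⟩
  obtain ⟨p', hp', ep'⟩ : (0 : ℝ) ∈ (fun x => G x - x) '' Icc (p - ρ) (p + ρ) :=
    intermediate_value_Icc (by linarith) hψ.continuousOn ⟨by linarith, by linarith⟩
  simp only at eq' er' ep'
  refine ⟨(m₂ + 1) / 2, p', q', r', hq', ?_, ?_, ?_, hκ, hG, strictMono_of_deriv_pos hG', hGdeg,
    by linarith, by linarith, by linarith, ?_, ?_, ?_⟩
  · linarith [hp'.2, hq'.1]
  · linarith [hr'.1, hq'.2]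
  · linarith [hr'.2, hp'.1]
  · intro x hx
    -- Three zones: near `p'` the displacement increases from zero, on `[p + ρ, a]` it is positive
    -- by compactness, and from `a` on it decreases to zero at `q'`. The interval `(q', r')` is
    -- treated in the same way.
    rcases le_total x (p + ρ) with h | h
    · have := hGmono' hp' (b := x) ⟨by linarith [hx.1, hp'.1], h⟩ hx.1
      simp only at this
      linarith
    rcases le_total x a with h' | h'
    · exact hGpos x ⟨h, h'⟩
    · have := hGanti (a := x) ⟨h', by linarith [hx.2, hq'.2]⟩ hq' hx.2
      simp only at this
      linarith
  · intro x hx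
    rcases le_total (r - ρ) x with h | h
    · have := hGmono (a := x) ⟨h, by linarith [hx.2, hr'.2]⟩ (b := r')
        ⟨hr'.1, by linarith [hr'.2]⟩ hx.2
      simp only at this
      linarith
    rcases le_total b x with h' | h'
    · exact hGneg x ⟨h', h⟩
    · have := hGanti hq' (b := x) ⟨by linarith [hx.1, hq'.1], h'⟩ hx.1
      simp only at this
      linarith
  · intro x hx
    exact hGout x ⟨by linarith [hx.1, hr'.1], by linarith [hp'.2, hx.2]⟩

/-- Continuous lifts of the same circle map differ by an integer. -/
lemma exists_int_eq_add_of_lifts {F G : ℝ → ℝ} (hF : Continuous F) (hG : Continuous G)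
    (h : ∀ t, (F t : UnitAddCircle) = G t) : ∃ k : ℤ, ∀ t, G t = F t + k := by
  choose k hk using fun t => coe_eq_coe_iff_exists_int.1 (h t)
  have hc : Continuous k := by
    have : Continuous fun t => ((k t : ℤ) : ℝ) := by
      have e : (fun t => ((k t : ℤ) : ℝ)) = fun t => G t - F t := by ext t; rw [hk t]; ring
      rw [e]; exact hG.sub hF
    exact Int.isClosedEmbedding_coe_real.isEmbedding.continuous_iff.2 this
  refine ⟨k 0, fun t => ?_⟩
  rw [hk t, PreconnectedSpace.constant inferInstance hc (x := t) (y := 0)]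

/-- A map `C¹`-close to one of degree `d` has a `C¹`-close lift of degree `d`. -/
lemma C1Close.exists_lift {f g : UnitAddCircle → UnitAddCircle} {F : ℝ → ℝ} {d : ℕ} {η : ℝ}
    (h : C1Close η f g) (hη : η ≤ 1 / 2) (hF : IsC1Lift F f) (hdeg : ∀ x, F (x + 1) = F x + d) :
    ∃ G : ℝ → ℝ, IsC1Lift G g ∧ (∀ x, G (x + 1) = G x + d) ∧
      ∀ t, |F t - G t| < η ∧ |deriv F t - deriv G t| < η := by
  obtain ⟨F₁, G₁, hF₁, hG₁, hcl⟩ := h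
  obtain ⟨k, hk⟩ := exists_int_eq_add_of_lifts hF.1.continuous hF₁.1.continuous
    (fun t => by rw [← hF.2, hF₁.2])
  have hcl' : ∀ t, |F t - (G₁ t - k)| < η ∧ |deriv F t - deriv (fun t => G₁ t - k) t| < η := by
    intro t
    obtain ⟨h1, h2⟩ := hcl t
    rw [funext hk, deriv_add_const] at h2
    rw [hk t] at h1
    refine ⟨?_, by rwa [deriv_sub_const]⟩
    rwa [show F t - (G₁ t - k) = F t + k - G₁ t by ring]
  have hlift : ∀ t : ℝ, g t = ((G₁ t - k : ℝ) : UnitAddCircle) := fun t => by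
    rw [hG₁.2, ← coe_add_int (G₁ t - k) k, sub_add_cancel]
  refine ⟨fun t => G₁ t - k, ⟨hG₁.1.sub contDiff_const, hlift⟩, fun x => ?_, hcl'⟩
  have e : ((G₁ x - k : ℝ) : UnitAddCircle) = (G₁ (x + 1) - k : ℝ) := by
    rw [← hlift, ← hlift]; congr 1; exact (AddCircle.coe_add_period 1 x).symm
  obtain ⟨m, hm⟩ := coe_eq_coe_iff_exists_int.1 e
  obtain ⟨h1, h2⟩ := abs_lt.1 (hcl' x).1
  obtain ⟨h3, h4⟩ := abs_lt.1 (hcl' (x + 1)).1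
  rw [hm, hdeg] at h3 h4
  -- The integer `m` differs from `d` by less than `2η ≤ 1`; this is the reason for the bound `1 /
  -- 2` on `η`.
  have hmd : m = d := by
    have h5 : (m : ℝ) < d + 1 := by linarith
    have h6 : (d : ℝ) < m + 1 := by linarith
    have h7 : m < d + 1 := by exact_mod_cast h5
    have h8 : (d : ℤ) < m + 1 := by exact_mod_cast h6
    omega
  simp only [hm, hmd]; push_cast; rfl

/-! ### Dynamics of gap lifts on the circle -/

/-- If the lift stretches `[a, b]` to length at least one, then the circle map sends the
corresponding arc onto the circle. -/
lemma iterate_image_eq_univ {F : ℝ → ℝ} {f : UnitAddCircle → UnitAddCircle} (hc : Continuous F)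
    (hf : ∀ t : ℝ, f t = (F t : UnitAddCircle)) {a b : ℝ} (hab : a ≤ b) {n : ℕ}
    (hn : F^[n] a + 1 ≤ F^[n] b) {V : Set UnitAddCircle}
    (hV : ∀ t ∈ Icc a b, (t : UnitAddCircle) ∈ V) : f^[n] '' V = univ := by
  refine eq_univ_of_forall fun y => ?_
  have hy : y ∈ ((↑) : ℝ → UnitAddCircle) '' Icc (F^[n] a) (F^[n] a + 1) := by
    rw [AddCircle.coe_image_Icc_eq]; trivial
  obtain ⟨s, hs, rfl⟩ := hy
  obtain ⟨t, ht, rfl⟩ := intermediate_value_Icc hab (hc.iterate n).continuousOn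
    ⟨hs.1, hs.2.trans hn⟩
  exact ⟨t, hV t ht, iterate_coe hf n t⟩

lemma exists_Icc_subset_of_mem_nhds {t : ℝ} {V : Set UnitAddCircle}
    (hV : V ∈ 𝓝 (t : UnitAddCircle)) :
    ∃ a b, a < t ∧ t < b ∧ ∀ s ∈ Icc a b, (s : UnitAddCircle) ∈ V := by
  have h : ((↑) : ℝ → UnitAddCircle) ⁻¹' V ∈ 𝓝 t :=
    (AddCircle.continuous_mk' 1).continuousAt.preimage_mem_nhds hV
  obtain ⟨e, he, hb⟩ := Metric.nhds_basis_closedBall.mem_iff.1 h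
  rw [Real.closedBall_eq_Icc] at hb
  exact ⟨t - e, t + e, by linarith, by linarith, fun s hs => hb hs⟩

/-- Non-wandering requires a positive time; this replaces a possible time `0` by a later one. -/
lemma iterate_add_one_le_succ {F : ℝ → ℝ} {d : ℕ} (hd : 1 ≤ d) (hmono : Monotone F)
    (hdeg : ∀ x, F (x + 1) = F x + d) {a b : ℝ} {n : ℕ} (hn : F^[n] a + 1 ≤ F^[n] b) :
    F^[n + 1] a + 1 ≤ F^[n + 1] b := by
  rw [Function.iterate_succ_apply', Function.iterate_succ_apply']
  have h := hmono hn
  rw [hdeg] at h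
  have : (1 : ℝ) ≤ d := by exact_mod_cast hd
  linarith

namespace IsGapLift

variable {d : ℕ} {κ p q r : ℝ} {F : ℝ → ℝ}

lemma lt_pr (h : IsGapLift d κ p q r F) : p < r := h.lt_pq.trans h.lt_qr

/-- Points to the left of the gap are pushed at distance at least one from it. -/
lemma exists_iterate_le (h : IsGapLift d κ p q r F) (hd : 2 ≤ d) {y : ℝ} (hy : y < p) :
    ∃ m, F^[m] y + 1 ≤ p := by
  by_contra! hcon
  have hd' : (2 : ℝ) ≤ d := by exact_mod_cast hd
  have hlt : ∀ m, F^[m] y < p := fun m => by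
    have := (h.strictMono.iterate m) hy
    rwa [Function.iterate_fixed h.map_p] at this
  have hgrow : ∀ m, κ ^ m * (p - y) ≤ p - F^[m] y := by
    intro m
    induction m with
    | zero => simp
    | succ m ih =>
      -- Otherwise the orbit lies below `r - 1`, whose image `r - d` is already more than one below
      -- `p` because `d ≥ 2`.
      have hr : r ≤ F^[m] y + 1 := by
        by_contra! hc
        have h1 := h.strictMono hc
        rw [h.map_add_one, h.map_r] at h1
        have h2 := hcon (m + 1)
        rw [Function.iterate_succ_apply'] at h2
        linarith [h.lt_rp]
      have h1 := h.expand (x := F^[m] y + 1) (y := p + 1) ⟨hr, by linarith [hlt m]⟩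
        ⟨h.lt_rp.le, le_rfl⟩ (by linarith [hlt m])
      rw [h.map_add_one, h.map_add_one, h.map_p] at h1
      rw [Function.iterate_succ_apply', pow_succ']
      have h2 := mul_le_mul_of_nonneg_left ih (by linarith [h.one_lt] : 0 ≤ κ)
      linarith
  obtain ⟨m, hm⟩ := pow_unbounded_of_one_lt (1 / (p - y)) h.one_lt
  rw [div_lt_iff₀ (sub_pos.2 hy)] at hm
  linarith [hgrow m, hcon m]

/-- Points to the right of the gap are pushed at distance at least one from it. -/
lemma exists_le_iterate (h : IsGapLift d κ p q r F) (hd : 2 ≤ d) {y : ℝ} (hy : r < y) :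
    ∃ m, r + 1 ≤ F^[m] y := by
  by_contra! hcon
  have hd' : (2 : ℝ) ≤ d := by exact_mod_cast hd
  have hlt : ∀ m, r < F^[m] y := fun m => by
    have := (h.strictMono.iterate m) hy
    rwa [Function.iterate_fixed h.map_r] at this
  have hgrow : ∀ m, κ ^ m * (y - r) ≤ F^[m] y - r := by
    intro m
    induction m with
    | zero => simp
    | succ m ih =>
      -- Beyond `p + 1` the next iterate would exceed `p + d`, hence `r + 1`.
      have hr : F^[m] y ≤ p + 1 := by
        by_contra! hc
        have h1 := h.strictMono hc
        rw [h.map_add_one, h.map_p] at h1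
        have h2 := hcon (m + 1)
        rw [Function.iterate_succ_apply'] at h2
        linarith [h.lt_rp]
      have h1 := h.expand (x := r) (y := F^[m] y) ⟨le_rfl, h.lt_rp.le⟩
        ⟨(hlt m).le, hr⟩ (hlt m).le
      rw [h.map_r] at h1
      rw [Function.iterate_succ_apply', pow_succ']
      have h2 := mul_le_mul_of_nonneg_left ih (by linarith [h.one_lt] : 0 ≤ κ)
      linarith
  obtain ⟨m, hm⟩ := pow_unbounded_of_one_lt (1 / (y - r)) h.one_lt
  rw [div_lt_iff₀ (sub_pos.2 hy)] at hm
  linarith [hgrow m, hcon m]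

/-- Intervals around points whose orbit avoids the gap grow to length one. -/
lemma exists_iterate_add_one_le (h : IsGapLift d κ p q r F) (hd : 2 ≤ d) {a t b : ℝ}
    (hat : a < t) (htb : t < b) (ht : ∀ n, ∀ k : ℤ, F^[n] t - k ∉ Ioo p r) :
    ∃ n, F^[n] a + 1 ≤ F^[n] b := by
  by_contra! hcon
  have hat' : ∀ n, F^[n] a < F^[n] t := fun n => h.strictMono.iterate n hat
  have htb' : ∀ n, F^[n] t < F^[n] b := fun n => h.strictMono.iterate n htb
  have hsub : ∀ n m : ℕ, ∀ x : ℝ, ∀ k : ℤ,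
      F^[m] (F^[n] x) = F^[m] (F^[n] x - k) + (d : ℝ) ^ m * k := fun n m x k => by
    have := iterate_map_add_intCast h.map_add_one m (F^[n] x - k) k
    rwa [sub_add_cancel] at this
  -- If an image of the interval straddled a translate of `p`, its left end would be pushed one unit
  -- away while its right end stayed beyond the fixed point, making the length at least one. The
  -- same holds for `r`.
  have hp : ∀ n, ∀ k : ℤ, F^[n] a - k < p → F^[n] b - k ≤ p := by
    intro n k h1
    by_contra! h2
    obtain ⟨m, hm⟩ := h.exists_iterate_le hd h1
    have h3 := h.strictMono.iterate m h2
    rw [Function.iterate_fixed h.map_p] at h3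
    have h4 := hcon (m + n)
    rw [Function.iterate_add_apply, Function.iterate_add_apply, hsub n m a k, hsub n m b k] at h4
    linarith
  have hr : ∀ n, ∀ k : ℤ, r < F^[n] b - k → r ≤ F^[n] a - k := by
    intro n k h1
    by_contra! h2
    obtain ⟨m, hm⟩ := h.exists_le_iterate hd h1
    have h3 := h.strictMono.iterate m h2
    rw [Function.iterate_fixed h.map_r] at h3
    have h4 := hcon (m + n)
    rw [Function.iterate_add_apply, Function.iterate_add_apply, hsub n m a k, hsub n m b k] at h4
    linarith
  have hgrow : ∀ n, κ ^ n * (b - a) ≤ F^[n] b - F^[n] a := by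
    intro n
    induction n with
    | zero => simp
    | succ n ih =>
      -- After translation by `k` the middle point lies in `[p, p + 1)`, outside the gap, and it is
      -- not `p`, which would be straddled. So the whole image lies in `[r, p + 1]`, where `F`
      -- expands.
      set k := ⌊F^[n] t - p⌋ with hk
      have k1 : (k : ℝ) ≤ F^[n] t - p := Int.floor_le _
      have k2 : F^[n] t - p < k + 1 := Int.lt_floor_add_one _
      have hrt : r ≤ F^[n] t - k := by
        by_contra! hc
        have hpt : F^[n] t - k = p := by
          by_contra hne
          exact ht n k ⟨lt_of_le_of_ne (by linarith) (Ne.symm hne), hc⟩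
        have := hp n k (by linarith [hat' n])
        linarith [htb' n]
      have ha : r ≤ F^[n] a - k := hr n k (by linarith [htb' n])
      have hb : F^[n] b - k ≤ p + 1 := by
        have := hp n (k + 1) (by push_cast; linarith [hat' n])
        push_cast at this
        linarith
      have hab : F^[n] a - k ≤ F^[n] b - k := by linarith [hat' n, htb' n]
      have h1 := h.expand ⟨ha, hab.trans hb⟩ ⟨ha.trans hab, hb⟩ hab
      have e : ∀ x : ℝ, F x = F (x - k) + d * k := fun x => by
        have := map_add_intCast h.map_add_one (x - k) k
        rwa [sub_add_cancel] at this
      rw [Function.iterate_succ_apply', Function.iterate_succ_apply', pow_succ', e (F^[n] b),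
        e (F^[n] a)]
      have h2 := mul_le_mul_of_nonneg_left ih (by linarith [h.one_lt] : 0 ≤ κ)
      linarith
  have hab : 0 < b - a := by linarith
  obtain ⟨m, hm⟩ := pow_unbounded_of_one_lt (1 / (b - a)) h.one_lt
  rw [div_lt_iff₀ hab] at hm
  linarith [hgrow m, hcon m]

end IsGapLift

/-- The arc of the circle that is the projection of `(p, r)`. -/
def gapArc (p r : ℝ) : Set UnitAddCircle :=
  Set.image ((↑) : ℝ → UnitAddCircle) (Ioo p r)

/-- The points whose orbit under `f` never enters the arc `(p, r)`. -/
def avoidingSet (f : UnitAddCircle → UnitAddCircle) (p r : ℝ) : Set UnitAddCircle :=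
  {x | ∀ n, f^[n] x ∉ gapArc p r}

lemma isOpen_gapArc (p r : ℝ) : IsOpen (gapArc p r) :=
  QuotientAddGroup.isOpenMap_coe _ isOpen_Ioo

lemma coe_mem_gapArc {p r t : ℝ} : (t : UnitAddCircle) ∈ gapArc p r ↔ ∃ k : ℤ, t - k ∈ Ioo p r := by
  constructor
  · rintro ⟨s, hs, hst⟩
    obtain ⟨k, rfl⟩ := coe_eq_coe_iff_exists_int.1 hst
    exact ⟨k, by simpa using hs⟩
  · rintro ⟨k, hk⟩
    refine ⟨_, hk, ?_⟩
    rw [← coe_add_int (t - k) k, sub_add_cancel]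

lemma endpoint_notMem_gapArc {p r t : ℝ} (hrp : r < p + 1) (ht : t = p ∨ t = r) :
    (t : UnitAddCircle) ∉ gapArc p r := by
  rw [coe_mem_gapArc]
  rintro ⟨k, h1, h2⟩
  rcases ht with rfl | rfl
  · have h3 : (k : ℝ) < 0 := by linarith
    have h4 : (-1 : ℝ) < k := by linarith
    have h5 : k < 0 := by exact_mod_cast h3
    have h6 : -1 < k := by exact_mod_cast h4
    omega
  · have h3 : (0 : ℝ) < k := by linarith
    have h4 : (k : ℝ) < 1 := by linarith
    have h5 : 0 < k := by exact_mod_cast h3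
    have h6 : k < 1 := by exact_mod_cast h4
    omega

namespace IsGapLift

variable {d : ℕ} {κ p q r : ℝ} {F : ℝ → ℝ} {f : UnitAddCircle → UnitAddCircle}

lemma continuous_circle (h : IsGapLift d κ p q r F) (hf : ∀ t : ℝ, f t = (F t : UnitAddCircle)) :
    Continuous f := by
  have : Continuous fun t : ℝ => f t := by
    simp only [hf]; exact (AddCircle.continuous_mk' 1).comp h.contDiff.continuous
  exact isQuotientMap_quotient_mk'.continuous_iff.2 this

lemma map_mem_gapArc (h : IsGapLift d κ p q r F) (hf : ∀ t : ℝ, f t = (F t : UnitAddCircle))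
    {x : UnitAddCircle} (hx : x ∈ gapArc p r) : f x ∈ gapArc p r := by
  obtain ⟨t, ht, rfl⟩ := hx
  rw [hf]
  exact ⟨F t, ⟨h.map_p ▸ h.strictMono ht.1, h.map_r ▸ h.strictMono ht.2⟩, rfl⟩

lemma iterate_mem_gapArc (h : IsGapLift d κ p q r F) (hf : ∀ t : ℝ, f t = (F t : UnitAddCircle))
    {x : UnitAddCircle} (hx : x ∈ gapArc p r) (n : ℕ) : f^[n] x ∈ gapArc p r := by
  induction n with
  | zero => exact hx
  | succ n ih => rw [Function.iterate_succ_apply']; exact h.map_mem_gapArc hf ih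

lemma iterate_endpoint (h : IsGapLift d κ p q r F) (hf : ∀ t : ℝ, f t = (F t : UnitAddCircle))
    {t : ℝ} (ht : t = p ∨ t = r) (n : ℕ) : f^[n] t = t := by
  refine Function.iterate_fixed ?_ n
  rcases ht with rfl | rfl
  · rw [hf, h.map_p]
  · rw [hf, h.map_r]

lemma endpoint_mem_avoidingSet (h : IsGapLift d κ p q r F)
    (hf : ∀ t : ℝ, f t = (F t : UnitAddCircle)) {t : ℝ} (ht : t = p ∨ t = r) :
    (t : UnitAddCircle) ∈ avoidingSet f p r := fun n => by
  rw [h.iterate_endpoint hf ht]; exact endpoint_notMem_gapArc h.lt_rp ht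

/-- The gap is forward invariant, so avoiding it depends only on the tail of the orbit. -/
lemma iterate_mem_avoidingSet_iff (h : IsGapLift d κ p q r F)
    (hf : ∀ t : ℝ, f t = (F t : UnitAddCircle)) {x : UnitAddCircle} (n : ℕ) :
    f^[n] x ∈ avoidingSet f p r ↔ x ∈ avoidingSet f p r := by
  constructor
  · intro hx m hm
    apply hx m
    rw [← Function.iterate_add_apply, add_comm, Function.iterate_add_apply]
    exact h.iterate_mem_gapArc hf hm n
  · intro hx m
    rw [← Function.iterate_add_apply]
    exact hx _

/-- Neighbourhoods of points of the avoiding set are eventually mapped onto the circle. -/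
lemma exists_image_eq_univ (h : IsGapLift d κ p q r F) (hd : 2 ≤ d)
    (hf : ∀ t : ℝ, f t = (F t : UnitAddCircle)) {x : UnitAddCircle} (hx : x ∈ avoidingSet f p r)
    {V : Set UnitAddCircle} (hV : V ∈ 𝓝 x) : ∃ n, 1 ≤ n ∧ f^[n] '' V = univ := by
  induction x using QuotientAddGroup.induction_on with | H t => ?_
  obtain ⟨a, b, hat, htb, hab⟩ := exists_Icc_subset_of_mem_nhds hV
  obtain ⟨n, hn⟩ := h.exists_iterate_add_one_le hd hat htb fun n k hk =>
    hx n (by rw [iterate_coe hf]; exact coe_mem_gapArc.2 ⟨k, hk⟩)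
  exact ⟨n + 1, by omega, iterate_image_eq_univ h.contDiff.continuous hf (hat.trans htb).le
    (iterate_add_one_le_succ (by omega) h.strictMono.monotone h.map_add_one hn) hab⟩

lemma q_mem_gapArc (h : IsGapLift d κ p q r F) : (q : UnitAddCircle) ∈ gapArc p r :=
  ⟨q, ⟨h.lt_pq, h.lt_qr⟩, rfl⟩

lemma isClosed_avoidingSet (h : IsGapLift d κ p q r F)
    (hf : ∀ t : ℝ, f t = (F t : UnitAddCircle)) : IsClosed (avoidingSet f p r) := by
  simp only [avoidingSet, Set.ofPred_forall]
  exact isClosed_iInter fun n =>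
    (isOpen_gapArc p r).isClosed_compl.preimage ((h.continuous_circle hf).iterate n)

/-- Both properties come from neighbourhoods being spread over the circle. Such an image contains
points of the set other than the image of `x`, and their preimages accumulate at `x`. A connected
subset with two points would contain an arc, some iterate of which would meet the gap. -/
lemma isCantor_avoidingSet (h : IsGapLift d κ p q r F) (hd : 2 ≤ d)
    (hf : ∀ t : ℝ, f t = (F t : UnitAddCircle)) : IsCantor (avoidingSet f p r) := by
  refine ⟨⟨p, h.endpoint_mem_avoidingSet hf (Or.inl rfl)⟩,
    ⟨h.isClosed_avoidingSet hf, fun x hx => ?_⟩, fun S hS hSc => ?_⟩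
  · rw [accPt_iff_nhds]
    intro V hV
    obtain ⟨n, -, hn⟩ := h.exists_image_eq_univ hd hf hx hV
    have hpr : (p : UnitAddCircle) ≠ r := by
      intro e
      obtain ⟨k, hk⟩ := coe_eq_coe_iff_exists_int.1 e
      have h1 := h.lt_pr
      have h2 := h.lt_rp
      have h3 : (0 : ℝ) < k := by linarith
      have h4 : (k : ℝ) < 1 := by linarith
      have h5 : 0 < k := by exact_mod_cast h3
      have h6 : k < 1 := by exact_mod_cast h4
      omega
    obtain ⟨c, hc, hcx⟩ : ∃ c ∈ avoidingSet f p r, c ≠ f^[n] x := by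
      by_cases hp : (p : UnitAddCircle) = f^[n] x
      · exact ⟨r, h.endpoint_mem_avoidingSet hf (Or.inr rfl), fun e => hpr (hp.trans e.symm)⟩
      · exact ⟨p, h.endpoint_mem_avoidingSet hf (Or.inl rfl), hp⟩
    obtain ⟨v, hv, rfl⟩ : c ∈ f^[n] '' V := hn ▸ mem_univ c
    exact ⟨v, ⟨hv, (h.iterate_mem_avoidingSet_iff hf n).1 hc⟩, fun e => hcx (by rw [e])⟩
  · intro x hx y hy
    by_contra hxy
    have hqS : ∀ z ∈ S, z ≠ (q : UnitAddCircle) := fun z hz e =>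
      hS hz 0 (by rw [e]; exact h.q_mem_gapArc)
    -- Cutting the circle at `q`, which `S` misses, gives a real coordinate continuous on `S`.
    set c : UnitAddCircle → ℝ := fun z => (AddCircle.equivIco 1 q z : ℝ) with hcdef
    have hcoe : ∀ z, (c z : UnitAddCircle) = z := fun z => AddCircle.coe_equivIco
    have hcont : ContinuousOn c S := fun z hz =>
      (continuous_subtype_val.continuousAt.comp
        (AddCircle.continuousAt_equivIco 1 q (hqS z hz))).continuousWithinAt
    have hord : OrdConnected (c '' S) := (hSc.image c hcont).ordConnected
    have key : ∀ u ∈ S, ∀ v ∈ S, c u < c v → False := by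
      intro u hu v hv huv
      have hsub : ∀ t ∈ Icc (c u) (c v), (t : UnitAddCircle) ∈ S := fun t ht => by
        obtain ⟨z, hz, rfl⟩ := hord.out (mem_image_of_mem c hu) (mem_image_of_mem c hv) ht
        rwa [hcoe]
      obtain ⟨t, h1, h2⟩ := exists_between huv
      have hSn : S ∈ 𝓝 (t : UnitAddCircle) := by
        refine mem_of_superset (QuotientAddGroup.isOpenMap_coe.image_mem_nhds (Icc_mem_nhds h1 h2)) ?_
        rintro _ ⟨s, hs, rfl⟩
        exact hsub s hs
      obtain ⟨n, -, hn⟩ := h.exists_image_eq_univ hd hf (hS (hsub t ⟨h1.le, h2.le⟩)) hSn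
      obtain ⟨w, hw, hwq⟩ : (q : UnitAddCircle) ∈ f^[n] '' S := hn ▸ mem_univ _
      exact hS hw n (by rw [hwq]; exact h.q_mem_gapArc)
    rcases lt_trichotomy (c x) (c y) with hlt | heq | hgt
    · exact key x hx y hy hlt
    · exact hxy (by rw [← hcoe x, ← hcoe y, heq])
    · exact key y hy x hx hgt

/-- On the gap, iterates move points strictly towards `q`. -/
lemma iterate_strict (h : IsGapLift d κ p q r F) {t : ℝ} (n : ℕ) :
    (t ∈ Ioo p q → t < F^[n + 1] t ∧ F^[n + 1] t < q) ∧
      (t ∈ Ioo q r → F^[n + 1] t < t ∧ q < F^[n + 1] t) := by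
  constructor
  · intro ht
    have hq : ∀ m, F^[m] t < q := fun m => by
      have := h.strictMono.iterate m ht.2
      rwa [Function.iterate_fixed h.map_q] at this
    refine ⟨?_, hq _⟩
    have hstep : ∀ m, t ≤ F^[m] t := by
      intro m
      induction m with
      | zero => exact le_rfl
      | succ m ih =>
        rw [Function.iterate_succ_apply']
        exact ih.trans (h.lt_map _ ⟨ht.1.trans_le ih, hq m⟩).le
    rw [Function.iterate_succ_apply']
    exact (hstep n).trans_lt (h.lt_map _ ⟨ht.1.trans_le (hstep n), hq n⟩)
  · intro ht
    have hq : ∀ m, q < F^[m] t := fun m => by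
      have := h.strictMono.iterate m ht.1
      rwa [Function.iterate_fixed h.map_q] at this
    refine ⟨?_, hq _⟩
    have hstep : ∀ m, F^[m] t ≤ t := by
      intro m
      induction m with
      | zero => exact le_rfl
      | succ m ih =>
        rw [Function.iterate_succ_apply']
        exact (h.map_lt _ ⟨hq m, ih.trans_lt ht.2⟩).le.trans ih
    rw [Function.iterate_succ_apply']
    exact (h.map_lt _ ⟨hq n, (hstep n).trans_lt ht.2⟩).trans_le (hstep n)

lemma eq_of_coe_eq_of_mem_Ioo (h : IsGapLift d κ p q r F) {s t : ℝ} (hs : s ∈ Ioo p r)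
    (ht : t ∈ Ioo p r) (hst : (s : UnitAddCircle) = t) : s = t := by
  refine (AddCircle.coe_eq_coe_iff_of_mem_Ico (p := (1 : ℝ)) (a := p) ?_ ?_).1 hst
  · exact ⟨hs.1.le, hs.2.trans h.lt_rp⟩
  · exact ⟨ht.1.le, ht.2.trans h.lt_rp⟩

/-- Points of the gap other than the attracting fixed point are wandering. -/
lemma notMem_nonWandering_of_mem_gapArc (h : IsGapLift d κ p q r F)
    (hf : ∀ t : ℝ, f t = (F t : UnitAddCircle)) {t : ℝ} (ht : t ∈ Ioo p r) (htq : t ≠ q) :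
    (t : UnitAddCircle) ∉ nonWandering f := by
  intro hnw
  suffices H : ∃ a b, a < t ∧ t < b ∧ p < a ∧ b < r ∧
      ∀ s ∈ Ioo a b, ∀ n, F^[n + 1] s ∉ Ioo a b ∧ F^[n + 1] s ∈ Ioo p r by
    obtain ⟨a, b, ha, hb, hpa, hbr, hab⟩ := H
    obtain ⟨m, hm, y, ⟨x, ⟨s, hs, rfl⟩, rfl⟩, ⟨s', hs', hss'⟩⟩ := hnw _
      (QuotientAddGroup.isOpenMap_coe.image_mem_nhds (Ioo_mem_nhds ha hb))
    obtain ⟨n, rfl⟩ := Nat.exists_eq_add_of_le' hm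
    have hss'' : (s' : UnitAddCircle) = (F^[n + 1] s : ℝ) := hss'.trans (iterate_coe hf (n + 1) s)
    have := h.eq_of_coe_eq_of_mem_Ioo ⟨hpa.trans hs'.1, hs'.2.trans hbr⟩ (hab s hs n).2 hss''
    exact (hab s hs n).1 (this ▸ hs')
  have hFc := h.contDiff.continuous
  rcases htq.lt_or_gt with htq | htq
  · have hFt := h.lt_map t ⟨ht.1, htq⟩
    -- With `a < t < F a`, the interval `(a, F a)` is a neighbourhood of `t` that every positive
    -- iterate carries beyond `F a`.
    obtain ⟨a, ⟨hFa, hpa⟩, hat⟩ : ∃ a, (t < F a ∧ p < a) ∧ a < t := by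
      have := (((hFc.continuousAt (x := t)).eventually (lt_mem_nhds hFt)).and
        (lt_mem_nhds ht.1)).filter_mono (nhdsWithin_le_nhds (s := Iio t))
      exact (this.and self_mem_nhdsWithin).exists
    have haq : a ∈ Ioo p q := ⟨hpa, hat.trans htq⟩
    have hFaq : F a < q := h.map_q ▸ h.strictMono haq.2
    refine ⟨a, F a, hat, hFa, hpa, hFaq.trans h.lt_qr, fun s hs n => ?_⟩
    have hs' : s ∈ Ioo p q := ⟨hpa.trans hs.1, hs.2.trans hFaq⟩
    have hle : F a < F^[n + 1] s := by
      have h1 : F s ≤ F^[n + 1] s := by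
        rcases n with - | n
        · exact le_rfl
        · have hFs : F s ∈ Ioo p q :=
            ⟨h.map_p ▸ h.strictMono hs'.1, h.map_q ▸ h.strictMono hs'.2⟩
          exact ((h.iterate_strict n).1 hFs).1.le
      exact (h.strictMono hs.1).trans_le h1
    have := (h.iterate_strict n).1 hs'
    exact ⟨fun hc => hc.2.not_gt hle, hs'.1.trans this.1, this.2.trans h.lt_qr⟩
  · have hFt := h.map_lt t ⟨htq, ht.2⟩
    obtain ⟨b, ⟨hFb, hbr⟩, htb⟩ : ∃ b, (F b < t ∧ b < r) ∧ t < b := by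
      have := (((hFc.continuousAt (x := t)).eventually (gt_mem_nhds hFt)).and
        (gt_mem_nhds ht.2)).filter_mono (nhdsWithin_le_nhds (s := Ioi t))
      exact (this.and self_mem_nhdsWithin).exists
    have hbq : b ∈ Ioo q r := ⟨htq.trans htb, hbr⟩
    have hFbq : q < F b := h.map_q ▸ h.strictMono hbq.1
    refine ⟨F b, b, hFb, htb, h.lt_pq.trans hFbq, hbr, fun s hs n => ?_⟩
    have hs' : s ∈ Ioo q r := ⟨hFbq.trans hs.1, hs.2.trans hbr⟩
    have hle : F^[n + 1] s < F b := by
      have h1 : F^[n + 1] s ≤ F s := by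
        rcases n with - | n
        · exact le_rfl
        · have hFs : F s ∈ Ioo q r :=
            ⟨h.map_q ▸ h.strictMono hs'.1, h.map_r ▸ h.strictMono hs'.2⟩
          exact ((h.iterate_strict n).2 hFs).1.le
      exact h1.trans_lt (h.strictMono hs.2)
    have := (h.iterate_strict n).2 hs'
    exact ⟨fun hc => hc.1.not_gt hle, h.lt_pq.trans this.2, this.1.trans (hs.2.trans hbr)⟩

/-- Points that enter the gap after starting outside of it are wandering. -/
lemma notMem_nonWandering_of_iterate (h : IsGapLift d κ p q r F)
    (hf : ∀ t : ℝ, f t = (F t : UnitAddCircle)) {x : UnitAddCircle} {n : ℕ}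
    (hn : f^[n] x ∉ gapArc p r) (hn' : f^[n + 1] x ∈ gapArc p r) : x ∉ nonWandering f := by
  intro hnw
  -- Excluding the closed arc makes the neighbourhood open. Nothing is lost: its endpoints are
  -- fixed, so `f^[n] x` cannot be one of them and still enter the gap.
  set J : Set UnitAddCircle := ((↑) : ℝ → UnitAddCircle) '' Icc p r with hJ
  have hJc : IsClosed J := (isCompact_Icc.image (AddCircle.continuous_mk' 1)).isClosed
  have hfc := h.continuous_circle hf
  have hxJ : f^[n] x ∉ J := by
    rintro ⟨t, ht, htx⟩
    rw [← htx] at hn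
    rw [Function.iterate_succ_apply', ← htx] at hn'
    have hend : t = p ∨ t = r := by
      by_contra! hc
      exact hn ⟨t, ⟨lt_of_le_of_ne ht.1 hc.1.symm, lt_of_le_of_ne ht.2 hc.2⟩, rfl⟩
    rw [show f t = t from h.iterate_endpoint hf hend 1] at hn'
    exact hn hn'
  have hV : {y | f^[n] y ∉ J ∧ f^[n + 1] y ∈ gapArc p r} ∈ 𝓝 x :=
    inter_mem ((hJc.isOpen_compl.preimage (hfc.iterate n)).mem_nhds hxJ)
      (((isOpen_gapArc p r).preimage (hfc.iterate (n + 1))).mem_nhds hn')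
  obtain ⟨m, hm, y, ⟨z, hz, rfl⟩, hy⟩ := hnw _ hV
  obtain ⟨k, rfl⟩ := Nat.exists_eq_add_of_le' hm
  apply hy.1
  rw [← Function.iterate_add_apply, show n + (k + 1) = k + (n + 1) by ring,
    Function.iterate_add_apply]
  exact image_mono Ioo_subset_Icc_self (h.iterate_mem_gapArc hf hz.2 k)

/-- The first entry time into the gap decides: at time zero only `q` survives, at a positive time
the point wanders, and without entry neighbourhoods spread over the circle. -/
lemma nonWandering_eq (h : IsGapLift d κ p q r F) (hd : 2 ≤ d)
    (hf : ∀ t : ℝ, f t = (F t : UnitAddCircle)) :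
    nonWandering f = {(q : UnitAddCircle)} ∪ avoidingSet f p r := by
  ext x
  constructor
  · intro hx
    by_contra hc
    simp only [mem_union, mem_singleton_iff, not_or] at hc
    obtain ⟨hxq, hxa⟩ := hc
    simp only [avoidingSet, mem_ofPred_eq, not_forall, not_not] at hxa
    classical
    set n := Nat.find hxa with hn
    have h1 : f^[n] x ∈ gapArc p r := Nat.find_spec hxa
    rcases Nat.eq_zero_or_pos n with h0 | h0
    · rw [h0] at h1
      obtain ⟨t, ht, rfl⟩ := h1
      refine h.notMem_nonWandering_of_mem_gapArc hf ht ?_ hx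
      rintro rfl
      exact hxq rfl
    · obtain ⟨m, hm⟩ := Nat.exists_eq_add_of_le' h0
      refine h.notMem_nonWandering_of_iterate hf (n := m) (Nat.find_min hxa (by omega)) ?_ hx
      rw [← hm]; exact h1
  · rintro (hx | hx)
    · rw [mem_singleton_iff] at hx
      subst hx
      intro V hV
      refine ⟨1, le_rfl, q, ⟨q, mem_of_mem_nhds hV, ?_⟩, mem_of_mem_nhds hV⟩
      rw [Function.iterate_one, hf, h.map_q]
    · intro V hV
      obtain ⟨n, hn, hnV⟩ := h.exists_image_eq_univ hd hf hx hV
      exact ⟨n, hn, x, hnV ▸ mem_univ x, mem_of_mem_nhds hV⟩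

/-- The only hyperbolic attracting periodic point of a gap lift is the one in the gap. -/
lemma eq_of_isHyperbolicAttracting (h : IsGapLift d κ p q r F)
    (hf : ∀ t : ℝ, f t = (F t : UnitAddCircle)) {n : ℕ} {x : UnitAddCircle}
    (hx : IsHyperbolicAttracting f n x) : x = q := by
  obtain ⟨hn, hper, F₁, t, hF₁, rfl, hder⟩ := hx
  have hperk : ∀ k, f^[n * k] t = t := fun k => by
    rw [Function.iterate_mul]; exact Function.iterate_fixed hper k
  by_cases hxa : (t : UnitAddCircle) ∈ avoidingSet f p r
  · exfalso
    obtain ⟨k, hk⟩ := exists_int_eq_add_of_lifts h.contDiff.continuous hF₁.1.continuous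
      (fun t => by rw [← hf, hF₁.2])
    have hdF : deriv F₁ = deriv F := by rw [funext hk]; ext s; rw [deriv_add_const]
    have hdiff := hF₁.1.differentiable one_ne_zero
    have hbig : ∀ m, κ ^ m ≤ deriv (F₁^[m]) t := by
      intro m
      induction m with
      | zero => simp [Function.iterate_zero]
      | succ m ih =>
        have hcomp : deriv (F₁^[m + 1]) t = deriv F₁ (F₁^[m] t) * deriv (F₁^[m]) t := by
          rw [Function.iterate_succ']
          exact deriv_comp t (hdiff _) ((hdiff.iterate m) t)
        set s := F₁^[m] t with hs
        set j := ⌊s - p⌋ with hj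
        have j1 : (j : ℝ) ≤ s - p := Int.floor_le _
        have j2 : s - p < j + 1 := Int.lt_floor_add_one _
        have hsg : s - j ∉ Ioo p r := fun hc => hxa m (by
          rw [iterate_coe hF₁.2]; exact coe_mem_gapArc.2 ⟨j, hc⟩)
        have hp1 : ∀ y, deriv F (y + 1) = deriv F y + 0 := fun y => by
          rw [deriv_add_one h.map_add_one, add_zero]
        have hκ : κ ≤ deriv F₁ s := by
          rw [hdF]
          by_cases hrs : r ≤ s - j
          · have e := map_add_intCast hp1 (s - j) j
            rw [sub_add_cancel, zero_mul, add_zero] at e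
            rw [e]
            exact h.le_deriv _ ⟨hrs, by linarith⟩
          -- The left endpoint of the gap is not in `[r, p + 1)`, but by periodicity its derivative
          -- equals that at `p + 1`.
          · have hsp : s = p + j := by
              by_contra hne
              refine hsg ⟨lt_of_le_of_ne (by linarith) fun e => hne (by linarith), not_le.1 hrs⟩
            have e := map_add_intCast hp1 p j
            have e' := hp1 p
            rw [hsp, e, zero_mul, ← e']
            exact h.le_deriv _ ⟨h.lt_rp.le, le_rfl⟩
        rw [hcomp, pow_succ']
        exact mul_le_mul hκ ih (pow_nonneg (by linarith [h.one_lt]) m)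
          (by linarith [h.one_lt])
    have h1 := hbig n
    have h2 := one_lt_pow₀ h.one_lt hn.ne'
    have h3 := le_abs_self (deriv (F₁^[n]) t)
    linarith
  · simp only [avoidingSet, mem_ofPred_eq, not_forall, not_not] at hxa
    obtain ⟨m, hm⟩ := hxa
    have hmem : (t : UnitAddCircle) ∈ gapArc p r := by
      -- An orbit in the gap at time `m` is still there at time `n * m ≥ m`, when it is back at its
      -- start.
      rw [← hperk m, ← Nat.sub_add_cancel (Nat.le_mul_of_pos_left m hn), Function.iterate_add_apply]
      exact h.iterate_mem_gapArc hf hm _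
    obtain ⟨s, hs, hst⟩ := hmem
    rw [← hst] at hper ⊢
    rw [iterate_coe hf] at hper
    obtain ⟨k, rfl⟩ := Nat.exists_eq_add_of_le' hn
    have hFs : F^[k + 1] s ∈ Ioo p r := by
      have h1 := h.strictMono.iterate (k + 1) hs.1
      have h2 := h.strictMono.iterate (k + 1) hs.2
      rw [Function.iterate_fixed h.map_p] at h1
      rw [Function.iterate_fixed h.map_r] at h2
      exact ⟨h1, h2⟩
    have e := h.eq_of_coe_eq_of_mem_Ioo hFs hs hper
    rcases lt_trichotomy s q with hlt | rfl | hgt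
    · exact absurd e ((h.iterate_strict k).1 ⟨hs.1, hlt⟩).1.ne'
    · rfl
    · exact absurd e ((h.iterate_strict k).2 ⟨hgt, hs.2⟩).1.ne

end IsGapLift

/-! ### Nonsingular endomorphisms and the linear expanding map -/

lemma ncard_preimage_linearExpanding {d : ℕ} (hd : 0 < d) (y : UnitAddCircle) :
    (linearExpanding d ⁻¹' {y}).ncard = d := by
  induction y using QuotientAddGroup.induction_on with | H s => ?_
  have hd0 : (d : ℝ) ≠ 0 := by positivity
  have himg : linearExpanding d ⁻¹' {(s : UnitAddCircle)} =
      (fun j : ℕ => (((s + j) / d : ℝ) : UnitAddCircle)) '' (Finset.range d : Set ℕ) := by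
    ext x
    constructor
    · intro hx
      induction x using QuotientAddGroup.induction_on with | H t => ?_
      have hx' : ((d * t : ℝ) : UnitAddCircle) = s := by
        have : (d • (t : UnitAddCircle)) = s := hx
        rwa [← AddCircle.coe_nsmul, nsmul_eq_mul] at this
      obtain ⟨k, hk⟩ := coe_eq_coe_iff_exists_int.1 hx'
      have hdz : (0 : ℤ) < d := by exact_mod_cast hd
      have h0 := Int.emod_nonneg (-k) hdz.ne'
      have h1 := Int.emod_lt_of_pos (-k) hdz
      have h2 := Int.emod_add_mul_ediv (-k) d
      -- From `s = d t + k` one gets `t = (s - k) / d`, so the index of the preimage is the residue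
      -- of `-k` modulo `d`.
      refine ⟨((-k) % d).toNat, by
        rw [Finset.coe_range]; change ((-k) % (d : ℤ)).toNat < d; omega, ?_⟩
      refine coe_eq_coe_iff_exists_int.2 ⟨(-k) / d, ?_⟩
      have h3 : (((-k) % (d : ℤ)).toNat : ℝ) = (((-k) % (d : ℤ) : ℤ) : ℝ) := by
        exact_mod_cast congrArg (Int.cast : ℤ → ℝ) (Int.toNat_of_nonneg h0)
      have h4 : (((-k) % (d : ℤ) : ℤ) : ℝ) + d * (((-k) / (d : ℤ) : ℤ) : ℝ) = -k := by
        exact_mod_cast congrArg (Int.cast : ℤ → ℝ) h2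
      simp only [h3]
      field_simp
      linarith
    · rintro ⟨j, -, rfl⟩
      change d • (((s + j) / d : ℝ) : UnitAddCircle) = s
      rw [← AddCircle.coe_nsmul, nsmul_eq_mul, mul_div_cancel₀ _ hd0]
      exact_mod_cast coe_add_int s j
  rw [himg, Set.InjOn.ncard_image, Set.ncard_coe_finset, Finset.card_range]
  intro i hi j hj hij
  obtain ⟨k, hk⟩ := coe_eq_coe_iff_exists_int.1 hij
  rw [Finset.coe_range] at hi hj
  have hi' : i < d := hi
  have hj' : j < d := hj
  field_simp at hk
  have hk' : (j : ℤ) = i + d * k := by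
    have : (j : ℝ) = i + d * k := by linarith
    exact_mod_cast this
  have hk0 : k = 0 := by
    rcases lt_trichotomy k 0 with h | h | h
    · nlinarith
    · exact h
    · nlinarith
  subst hk0
  omega

/-- A `C¹` map of degree `d ≥ 1` with positive derivative is a nonsingular `d`-endomorphism. -/
lemma isNonsingularEndo_of_lift {F : ℝ → ℝ} {f : UnitAddCircle → UnitAddCircle} {d : ℕ}
    (hd : 0 < d) (hF : IsC1Lift F f) (hdeg : ∀ x, F (x + 1) = F x + d)
    (hpos : ∀ x, 0 < deriv F x) : IsNonsingularEndo d f := by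
  have hd0 : (0 : ℝ) < d := by exact_mod_cast hd
  -- `F / d` has degree one and descends to a homeomorphism `h` with `f = E_d ∘ h`, so the covering
  -- and the fibre count are inherited from `E_d`.
  obtain ⟨Φ, hΦ⟩ := exists_orderIso_of_degree (F := fun x => F x / d) (d := 1) one_pos
    (fun x y hxy => div_lt_div_of_pos_right (strictMono_of_deriv_pos hpos hxy) hd0)
    (hF.1.continuous.div_const _) (fun x => by rw [hdeg]; field_simp; simp)
  obtain ⟨h, hh⟩ := exists_circle_homeomorph Φ.toHomeomorph (fun x => by
    simp only [OrderIso.coe_toHomeomorph, hΦ, hdeg]; field_simp)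
  have hfh : f = linearExpanding d ∘ h := by
    ext x
    induction x using QuotientAddGroup.induction_on with | H t => ?_
    simp only [Function.comp_apply, linearExpanding, hh, hF.2, OrderIso.coe_toHomeomorph, hΦ]
    rw [← AddCircle.coe_nsmul, nsmul_eq_mul, mul_div_cancel₀ _ hd0.ne']
  have hsurj : Function.Surjective (linearExpanding d) := fun y => by
    have h1 := ncard_preimage_linearExpanding hd y
    obtain ⟨x, hx⟩ := Set.nonempty_of_ncard_ne_zero (h1.trans_ne hd.ne')
    exact ⟨x, hx⟩
  have : NeZero d := ⟨hd.ne'⟩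
  have hcov : IsCoveringMap (linearExpanding d) :=
    (AddCircle.isAddQuotientCoveringMap_nsmul_of_ne_zero (1 : ℝ) d).isCoveringMap
  refine ⟨⟨F, hF, hdeg, fun t => (hpos t).ne'⟩, ?_, ?_, fun y => ?_⟩
  · rw [hfh]; exact hsurj.comp h.surjective
  · rw [hfh]; exact hcov.comp_homeomorph h
  · rw [hfh, preimage_comp, ← h.image_symm,
      Set.ncard_image_of_injective _ h.symm.injective, ncard_preimage_linearExpanding hd]

lemma isC1Lift_linearExpanding (d : ℕ) : IsC1Lift (fun t => d * t) (linearExpanding d) :=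
  ⟨contDiff_const.mul contDiff_id, fun t => by
    rw [linearExpanding, ← AddCircle.coe_nsmul, nsmul_eq_mul]⟩

lemma deriv_natCast_mul (d : ℕ) (x : ℝ) : deriv (fun t : ℝ => d * t) x = d := by
  simp

lemma isNonsingularEndo_linearExpanding {d : ℕ} (hd : 0 < d) :
    IsNonsingularEndo d (linearExpanding d) :=
  isNonsingularEndo_of_lift hd (isC1Lift_linearExpanding d) (fun x => by ring)
    (fun x => by rw [deriv_natCast_mul]; exact_mod_cast hd)

lemma isStructurallyStable_linearExpanding {d : ℕ} (hd : 2 ≤ d) :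
    IsStructurallyStable (linearExpanding d) := by
  have hd' : (2 : ℝ) ≤ d := by exact_mod_cast hd
  have hE := isC1Lift_linearExpanding d
  have hEdeg : ∀ x : ℝ, d * (x + 1) = d * x + d := fun x => by ring
  have expand : ∀ {G : ℝ → ℝ}, ContDiff ℝ 1 G → (∀ x, 3 / 2 ≤ deriv G x) →
      ∀ x y, 3 / 2 * |x - y| ≤ |G x - G y| := by
    intro G hG hG' x y
    have key := fun {x y : ℝ} (hxy : x ≤ y) =>
      mul_sub_le_image_sub_of_le_deriv (hG.differentiable one_ne_zero) hG' hxy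
    rcases le_total x y with hxy | hxy
    · rw [abs_sub_comm, abs_sub_comm (G x), abs_of_nonneg (sub_nonneg.2 hxy)]
      exact (key hxy).trans (le_abs_self _)
    · rw [abs_of_nonneg (sub_nonneg.2 hxy)]
      exact (key hxy).trans (le_abs_self _)
  -- `1 / 2` serves twice: it forces `g` to have degree `d`, and it keeps the derivative above `d -
  -- 1 / 2 ≥ 3 / 2`.
  refine ⟨⟨_, hE⟩, 1 / 2, by norm_num, fun g hg => ?_⟩
  obtain ⟨G, hG, hGdeg, hclose⟩ := hg.exists_lift le_rfl hE hEdeg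
  have hG' : ∀ x, 3 / 2 ≤ deriv G x := fun x => by
    have := (abs_lt.1 (hclose x).2).2
    rw [deriv_natCast_mul] at this
    linarith
  have hE' : ∀ x, 3 / 2 ≤ deriv (fun t : ℝ => d * t) x := fun x => by
    rw [deriv_natCast_mul]; linarith
  obtain ⟨Φ, hΦ⟩ := exists_orderIso_of_degree (d := d) (by omega)
    (strictMono_of_deriv_pos fun x => by linarith [hE' x]) hE.1.continuous hEdeg
  obtain ⟨Γ, hΓ⟩ := exists_orderIso_of_degree (d := d) (by omega)
    (strictMono_of_deriv_pos fun x => by linarith [hG' x]) hG.1.continuous hGdeg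
  refine exists_semiconj_of_lifts (F := Φ) (G := Γ) (by rw [hΦ]; exact hE.2)
    (by rw [hΓ]; exact hG.2) ?_
  exact exists_conj_of_expanding (d := d) (by rw [hΦ]; exact hEdeg) (by rw [hΓ]; exact hGdeg)
    (by norm_num : (1 : ℝ) < 3 / 2) (by norm_num : (1 : ℝ) < 3 / 2)
    (by rw [hΦ]; exact expand hE.1 hE') (by rw [hΓ]; exact expand hG.1 hG')

lemma nonWandering_linearExpanding {d : ℕ} (hd : 2 ≤ d) :
    nonWandering (linearExpanding d) = univ := by
  have hd' : (1 : ℝ) < d := by exact_mod_cast hd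
  refine eq_univ_of_forall fun x V hV => ?_
  induction x using QuotientAddGroup.induction_on with | H t => ?_
  obtain ⟨a, b, hat, htb, hab⟩ := exists_Icc_subset_of_mem_nhds hV
  have hba : 0 < b - a := by linarith
  have hE := isC1Lift_linearExpanding d
  have hit : ∀ (n : ℕ) (x : ℝ), (fun t : ℝ => d * t)^[n] x = (d : ℝ) ^ n * x := fun n x => by
    induction n with
    | zero => simp
    | succ n ih => rw [Function.iterate_succ_apply', ih, pow_succ']; ring
  obtain ⟨n, hn⟩ := pow_unbounded_of_one_lt (1 / (b - a)) hd'
  rw [div_lt_iff₀ hba] at hn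
  have h1 : (fun t : ℝ => d * t)^[n] a + 1 ≤ (fun t : ℝ => d * t)^[n] b := by
    rw [hit, hit]; linarith
  have h2 := iterate_add_one_le_succ (by omega : 1 ≤ d)
    (fun x y hxy => mul_le_mul_of_nonneg_left hxy (by linarith)) (fun x => by ring) h1
  have h3 := iterate_image_eq_univ hE.1.continuous hE.2 (by linarith) h2 hab
  exact ⟨n + 1, by omega, t, h3 ▸ mem_univ _, mem_of_mem_nhds hV⟩

/-! ### Bump functions -/

namespace IsBump

variable {δ : ℝ} {U : ℝ → ℝ}

lemma neg (h : IsBump δ U) : IsBump δ fun x => U (-x) where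
  contDiff := h.contDiff.comp contDiff_neg
  eq_one x hx := h.eq_one _ ⟨by linarith [hx.2], by linarith [hx.1]⟩
  eq_zero x hx := h.eq_zero _ (by rwa [abs_neg])
  deriv_nonneg x hx := by
    rw [deriv_comp_neg]
    linarith [h.deriv_nonpos (-x) ⟨by linarith [hx.2], by linarith [hx.1]⟩]
  deriv_nonpos x hx := by
    rw [deriv_comp_neg]
    linarith [h.deriv_nonneg (-x) ⟨by linarith [hx.2], by linarith [hx.1]⟩]

/-- Outside the two monotone zones `U` is locally constant, so the sign holds on the whole line. It
gives `(x U)' ≤ U`, the source of every derivative bound for the family. -/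
lemma mul_deriv_nonpos (h : IsBump δ U) (x : ℝ) : x * deriv U x ≤ 0 := by
  by_cases h1 : δ < |x|
  · have : U =ᶠ[𝓝 x] fun _ => 0 := by
      filter_upwards [(isOpen_lt continuous_const continuous_abs).mem_nhds h1] with y hy
      exact h.eq_zero y (le_of_lt hy)
    rw [this.deriv_eq]; simp
  by_cases h2 : |x| < δ / 2
  · have : U =ᶠ[𝓝 x] fun _ => 1 := by
      filter_upwards [(isOpen_lt continuous_abs continuous_const).mem_nhds h2] with y hy
      exact h.eq_one y (abs_le.1 (le_of_lt hy))
    rw [this.deriv_eq]; simp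
  push Not at h1 h2
  rcases le_total 0 x with hx | hx
  · rw [abs_of_nonneg hx] at h1 h2
    exact mul_nonpos_of_nonneg_of_nonpos hx (h.deriv_nonpos x ⟨h2, h1⟩)
  · rw [abs_of_nonpos hx] at h1 h2
    exact mul_nonpos_of_nonpos_of_nonneg hx (h.deriv_nonneg x ⟨by linarith, by linarith⟩)

lemma antitoneOn (h : IsBump δ U) : AntitoneOn U (Ici 0) := by
  refine antitoneOn_of_deriv_nonpos (convex_Ici 0) h.contDiff.continuous.continuousOn
    (h.contDiff.differentiable one_ne_zero).differentiableOn fun x hx => ?_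
  rw [interior_Ici] at hx
  have := h.mul_deriv_nonpos x
  by_contra! hc
  exact absurd this (mul_pos hx hc).not_ge

lemma mem_Icc_of_nonneg (h : IsBump δ U) (hδ : 0 < δ) {x : ℝ} (hx : 0 ≤ x) : U x ∈ Icc 0 1 := by
  have h0 : U 0 = 1 := h.eq_one 0 ⟨by linarith, by linarith⟩
  have h1 : U (max x δ) = 0 := h.eq_zero _ ((le_max_right x δ).trans (le_abs_self _))
  exact ⟨h1 ▸ h.antitoneOn hx (hx.trans (le_max_left x δ)) (le_max_left x δ),
    h0 ▸ h.antitoneOn (mem_Ici.2 le_rfl) hx hx⟩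

lemma mem_Icc (h : IsBump δ U) (hδ : 0 < δ) (x : ℝ) : U x ∈ Icc 0 1 := by
  rcases le_total 0 x with hx | hx
  · exact h.mem_Icc_of_nonneg hδ hx
  · simpa using h.neg.mem_Icc_of_nonneg hδ (neg_nonneg.2 hx)

/-- A bump function crosses a regular level once on the positive half-line. -/
lemma exists_crossing (h : IsBump δ U) (hδ : 0 < δ) {c : ℝ} (hc : c ∈ Ioo 0 1)
    (hreg : ∀ x, U x = c → deriv U x ≠ 0) :
    ∃ r ∈ Ioo (δ / 2) δ, U r = c ∧ (∀ x ∈ Ioo 0 r, c < U x) ∧ ∀ x, r ≤ x → U x ≤ c := by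
  have h1 : U (δ / 2) = 1 := h.eq_one _ ⟨by linarith, le_rfl⟩
  have h2 : U δ = 0 := h.eq_zero _ (le_abs_self δ)
  obtain ⟨r, hr, hrc⟩ := intermediate_value_Ioo' (by linarith : δ / 2 ≤ δ)
    h.contDiff.continuous.continuousOn (show c ∈ Ioo (U δ) (U (δ / 2)) by rwa [h1, h2])
  have hr0 : 0 < r := by linarith [hr.1]
  refine ⟨r, hr, hrc, fun x hx => ?_, fun x hx => ?_⟩
  · refine lt_of_le_of_ne (hrc ▸ h.antitoneOn hx.1.le hr0.le hx.2.le) fun hcx => ?_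
    obtain ⟨y, hxy, hyr⟩ := exists_between hx.2
    -- By monotonicity, reaching `c` before `r` would make `U` constant on `[x, r]`, against
    -- regularity of the level.
    have hconst : ∀ z ∈ Icc x r, U z = c := fun z hz => by
      have hz0 : 0 ≤ z := hx.1.le.trans hz.1
      exact le_antisymm (hcx ▸ h.antitoneOn hx.1.le hz0 hz.1)
        (hrc ▸ h.antitoneOn hz0 hr0.le hz.2)
    have hev : U =ᶠ[𝓝 y] fun _ => c := by
      filter_upwards [Icc_mem_nhds hxy hyr] with z hz using hconst z hz
    exact hreg y (hconst y ⟨hxy.le, hyr.le⟩) (by rw [hev.deriv_eq]; simp)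
  · exact hrc ▸ h.antitoneOn hr0.le (hr0.le.trans hx) hx

end IsBump

/-! ### The lift of the two-parameter family -/

/-- The lift of `x ↦ d x + (-d + ε) x U(x) mod 1`. -/
noncomputable def bumpLift (d : ℕ) (ε : ℝ) (U : ℝ → ℝ) (x : ℝ) : ℝ :=
  d * x - (d - ε) * ((x - round x) * U (x - round x))

section BumpLift

variable {d : ℕ} {ε δ : ℝ} {U : ℝ → ℝ}

lemma bumpLift_add_one (x : ℝ) : bumpLift d ε U (x + 1) = bumpLift d ε U x + d := by
  simp only [bumpLift, round_add_one]
  push_cast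
  rw [show x + 1 - ((round x : ℝ) + 1) = x - round x by ring]; ring

/-- `round` jumps at half-integers, but there the bump vanishes. Since `δ < 1 / 4`, any integer
within `3 / 4` gives the same value, so the formula holds on open sets and smoothness follows. -/
lemma bumpLift_eq (hU : IsBump δ U) (hδ : δ < 1 / 4) {x : ℝ} {k : ℤ} (hx : |x - k| ≤ 3 / 4) :
    bumpLift d ε U x = d * x - (d - ε) * ((x - k) * U (x - k)) := by
  rw [bumpLift]
  by_cases hk : round x = k
  · rw [hk]
  · have h1 : |x - round x| ≤ 1 / 2 := abs_sub_round x
    have h2 : (1 : ℝ) ≤ |(round x : ℝ) - k| := by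
      have : 1 ≤ |round x - k| := Int.one_le_abs (sub_ne_zero.2 hk)
      exact_mod_cast this
    have h3 : |(round x : ℝ) - k| ≤ |x - round x| + |x - k| := by
      rw [abs_sub_comm x (round x)]
      have := abs_add_le ((round x : ℝ) - x) (x - k)
      rwa [sub_add_sub_cancel] at this
    rw [hU.eq_zero _ (by linarith), hU.eq_zero (x - k) (by linarith)]; ring

lemma bumpLift_eventuallyEq (hU : IsBump δ U) (hδ : δ < 1 / 4) {x : ℝ} {k : ℤ}
    (hx : |x - k| < 3 / 4) :
    bumpLift d ε U =ᶠ[𝓝 x] fun y => d * y - (d - ε) * ((y - k) * U (y - k)) := by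
  have : IsOpen {y : ℝ | |y - k| < 3 / 4} := isOpen_lt (by fun_prop) continuous_const
  filter_upwards [this.mem_nhds hx] with y hy
  exact bumpLift_eq hU hδ (le_of_lt hy)

lemma contDiff_bumpLift (hU : IsBump δ U) (hδ : δ < 1 / 4) : ContDiff ℝ 1 (bumpLift d ε U) := by
  rw [contDiff_iff_contDiffAt]
  intro x
  have hx : |x - round x| < 3 / 4 := (abs_sub_round x).trans_lt (by norm_num)
  refine ContDiffAt.congr_of_eventuallyEq ?_ (bumpLift_eventuallyEq hU hδ hx)
  have hsub : ContDiff ℝ 1 fun y : ℝ => y - round x := contDiff_id.sub contDiff_const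
  exact ((contDiff_const.mul contDiff_id).sub
    (contDiff_const.mul (hsub.mul (hU.contDiff.comp hsub)))).contDiffAt

lemma deriv_bumpLift (hU : IsBump δ U) (hδ : δ < 1 / 4) {x : ℝ} (hx : |x| < 3 / 4) :
    deriv (bumpLift d ε U) x = d - (d - ε) * (U x + x * deriv U x) := by
  have h0 : |x - ((0 : ℤ) : ℝ)| < 3 / 4 := by simpa using hx
  rw [(bumpLift_eventuallyEq hU hδ h0).deriv_eq]
  simp only [Int.cast_zero, sub_zero]
  have hUd := (hU.contDiff.differentiable one_ne_zero x).hasDerivAt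
  have := ((hasDerivAt_id x).const_mul (d : ℝ)).sub
    (((hasDerivAt_id x).mul hUd).const_mul ((d : ℝ) - ε))
  have e := this.deriv
  simp only [id, mul_one, one_mul] at e
  exact e

lemma bumpLift_eq_of_abs_le (hU : IsBump δ U) (hδ : δ < 1 / 4) {x : ℝ} (hx : |x| ≤ 3 / 4) :
    bumpLift d ε U x = d * x - (d - ε) * (x * U x) := by
  have := bumpLift_eq (d := d) (ε := ε) hU hδ (x := x) (k := 0) (by simpa using hx)
  simpa using this

/-- Since `U + x U' ≤ 1`, the derivative is at least `d - (d - ε) = ε`. -/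
lemma deriv_bumpLift_pos (hd : 2 ≤ d) (hε : ε ∈ Ioo (0 : ℝ) 1) (hδ : δ ∈ Ioo (0 : ℝ) (1 / 4))
    (hU : IsBump δ U) (x : ℝ) : 0 < deriv (bumpLift d ε U) x := by
  have hd' : (2 : ℝ) ≤ d := by exact_mod_cast hd
  have hper : ∀ y, deriv (bumpLift d ε U) (y + 1) = deriv (bumpLift d ε U) y + 0 := fun y => by
    rw [deriv_add_one bumpLift_add_one, add_zero]
  have e := map_add_intCast hper (x - round x) (round x)
  rw [sub_add_cancel, zero_mul, add_zero] at e
  rw [e, deriv_bumpLift hU hδ.2 ((abs_sub_round x).trans_lt (by norm_num))]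
  have h1 := (hU.mem_Icc hδ.1 (x - round x)).2
  have h2 := hU.mul_deriv_nonpos (x - round x)
  have h3 : 0 ≤ d - ε := by linarith [hε.2]
  have h4 := mul_le_mul_of_nonneg_left
    (by linarith : U (x - round x) + (x - round x) * deriv U (x - round x) ≤ 1) h3
  linarith [hε.1]

lemma isC1Lift_bumpLift {U : ℝ → ℝ → ℝ} (hδ : δ ∈ Ioo (0 : ℝ) (1 / 4)) (hU : IsBump δ (U δ)) :
    IsC1Lift (bumpLift d ε (U δ)) (bifFamily d U ε δ) := by
  refine ⟨contDiff_bumpLift hU hδ.2, fun t => ?_⟩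
  set k := ⌊t + 1 / 2⌋ with hk
  have h1 : (k : ℝ) ≤ t + 1 / 2 := Int.floor_le _
  have h2 : t + 1 / 2 < k + 1 := Int.lt_floor_add_one _
  have ht : (t : UnitAddCircle) = (t - k : ℝ) := by rw [← coe_add_int (t - k) k, sub_add_cancel]
  have hb : bumpLift d ε (U δ) t = bumpLift d ε (U δ) (t - k) + ((d * k : ℤ) : ℝ) := by
    have := map_add_intCast (bumpLift_add_one (d := d) (ε := ε) (U := U δ)) (t - k) k
    rw [sub_add_cancel] at this
    rw [this]; push_cast; rfl
  rw [hb, coe_add_int, ht, bifFamily, if_neg fun h => hδ.1.ne' h.2,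
    AddCircle.liftIco_coe_apply (by constructor <;> linarith),
    bumpLift_eq_of_abs_le hU hδ.2 (abs_le.2 ⟨by linarith, by linarith⟩)]
  congr 1; ring

/-- If the level `(d - 1) / (d - ε)` is regular, all maps near the family member are gap lifts. -/
lemma exists_forall_close_bumpLift (hd : 2 ≤ d) (hε : ε ∈ Ioo (0 : ℝ) 1)
    (hδ : δ ∈ Ioo (0 : ℝ) (1 / 4)) (hU : IsBump δ U)
    (hreg : ∀ x, U x = (d - 1) / (d - ε) → deriv U x ≠ 0) :
    ∃ η > 0, ∀ G : ℝ → ℝ, ContDiff ℝ 1 G → (∀ x, G (x + 1) = G x + d) →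
      (∀ t, |bumpLift d ε U t - G t| < η ∧ |deriv (bumpLift d ε U) t - deriv G t| < η) →
      ∃ κ p' q' r', q' ∈ Icc (-(δ / 2)) (δ / 2) ∧ IsGapLift d κ p' q' r' G := by
  have hd' : (2 : ℝ) ≤ d := by exact_mod_cast hd
  obtain ⟨hδ0, hδ4⟩ := hδ
  have hdε : 0 < d - ε := by linarith [hε.2]
  -- `c` is the value of `U` at the nonzero fixed points of the lift in the central period.
  set c : ℝ := (d - 1) / (d - ε) with hc
  have hcm : (d - ε) * c = d - 1 := by rw [hc]; field_simp
  have hc01 : c ∈ Ioo (0 : ℝ) 1 :=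
    ⟨div_pos (by linarith) hdε, (div_lt_one hdε).2 (by linarith [hε.2])⟩
  obtain ⟨r, hr, hrc, hr1, hr2⟩ := hU.exists_crossing hδ0 hc01 hreg
  obtain ⟨s, hs, hsc, hs1, hs2⟩ := hU.neg.exists_crossing hδ0 hc01 (fun x hx => by
    rw [deriv_comp_neg]; exact neg_ne_zero.2 (hreg _ hx))
  have hval : ∀ x, |x| ≤ 3 / 4 → bumpLift d ε U x - x = x * ((d - ε) * (c - U x)) := fun x hx => by
    rw [bumpLift_eq_of_abs_le hU hδ4 hx, mul_sub, hcm]; ring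
  -- The derivative exceeds `1` exactly when `U + x U' < c`. Where `U = c`, strictness comes from
  -- the regularity of the level.
  have hbig : ∀ x, |x| < 3 / 4 → U x ≤ c → 1 < deriv (bumpLift d ε U) x := by
    intro x hx hxc
    rw [deriv_bumpLift hU hδ4 hx]
    have h1 := hU.mul_deriv_nonpos x
    have h2 : U x + x * deriv U x < c := by
      rcases hxc.eq_or_lt with h | h
      · have hx0 : x ≠ 0 := by
          rintro rfl
          rw [hU.eq_one 0 ⟨by linarith, by linarith⟩] at h
          exact hc01.2.ne' h
        have := lt_of_le_of_ne h1 (mul_ne_zero hx0 (hreg x h))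
        linarith
      · linarith
    have := mul_lt_mul_of_pos_left h2 hdε
    linarith
  refine exists_forall_close_isGapLift (p := -s) (q := 0) (r := r) (contDiff_bumpLift hU hδ4)
    bumpLift_add_one (deriv_bumpLift_pos hd hε ⟨hδ0, hδ4⟩ hU) ?_ ?_ ?_ hr.1 ?_ ?_ ?_ ?_ ?_ ?_ ?_
  · linarith [hs.1]
  · linarith
  · linarith
  · linarith [hr.2, hs.2]
  · have := hval (-s) (abs_le.2 ⟨by linarith [hs.2], by linarith [hs.1]⟩)
    rw [hsc, sub_self, mul_zero, mul_zero] at this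
    linarith
  · have := hval r (abs_le.2 ⟨by linarith [hr.1], by linarith [hr.2]⟩)
    rw [hrc, sub_self, mul_zero, mul_zero] at this
    linarith
  · intro x hx
    rw [deriv_bumpLift hU hδ4 (abs_lt.2 ⟨by linarith [hx.1], by linarith [hx.2]⟩), hU.eq_one x hx]
    -- Maximality yields a zero derivative also at the two ends of the plateau.
    have hmem : ∀ y ∈ Icc (-(δ / 2)) (δ / 2), IsMaxOn U univ y := fun y hy z _ => by
      rw [mem_ofPred_eq, hU.eq_one y hy]; exact (hU.mem_Icc hδ0 z).2
    have hdz : deriv U x = 0 := (hmem x hx).isLocalMax univ_mem |>.deriv_eq_zero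
    rw [hdz]
    linarith [hε.2]
  · intro x hx
    -- The part of `[r, 1 - s]` beyond `1 / 2` is translated to the negative side, where the
    -- crossing at `-s` applies.
    rcases le_total x (1 / 2) with h | h
    · exact hbig x (abs_lt.2 ⟨by linarith [hx.1, hr.1], by linarith⟩) (hr2 x hx.1)
    · have := hs2 (-(x - 1)) (by linarith [hx.2])
      rw [neg_neg] at this
      have := hbig (x - 1) (abs_lt.2 ⟨by linarith, by linarith [hx.2, hs.1]⟩) this
      rwa [← deriv_add_one bumpLift_add_one, sub_add_cancel] at this
  · intro x hx
    have h1 := hs1 (-x) ⟨by linarith [hx.2], by linarith [hx.1]⟩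
    rw [neg_neg] at h1
    have h2 := hval x (abs_le.2 ⟨by linarith [hx.1, hs.2], by linarith [hx.2]⟩)
    have h3 : 0 < x * ((d - ε) * (c - U x)) :=
      mul_pos_of_neg_of_neg hx.2 (mul_neg_of_pos_of_neg hdε (by linarith))
    linarith
  · intro x hx
    have h1 := hr1 x hx
    have h2 := hval x (abs_le.2 ⟨by linarith [hx.1], by linarith [hx.2, hr.2]⟩)
    have h3 : x * ((d - ε) * (c - U x)) < 0 :=
      mul_neg_of_pos_of_neg hx.1 (mul_neg_of_pos_of_neg hdε (by linarith))
    linarith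

lemma isHyperbolicAttracting_zero {U : ℝ → ℝ → ℝ} (hε : ε ∈ Ioo (0 : ℝ) 1)
    (hδ : δ ∈ Ioo (0 : ℝ) (1 / 4)) (hU : IsBump δ (U δ)) :
    IsHyperbolicAttracting (bifFamily d U ε δ) 1 0 := by
  have hlift := isC1Lift_bumpLift (d := d) (ε := ε) hδ hU
  refine ⟨one_pos, ?_, _, 0, hlift, AddCircle.coe_zero 1, ?_⟩
  · have h := hlift.2 0
    rw [bumpLift_eq_of_abs_le hU hδ.2 (by norm_num)] at h
    simpa using h
  · rw [Function.iterate_one, deriv_bumpLift hU hδ.2 (by norm_num),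
      hU.eq_one 0 ⟨by linarith [hδ.1], by linarith [hδ.1]⟩, abs_lt]
    constructor <;> linarith [hε.1, hε.2]

lemma tendstoUniformly_bifFamily {U : ℝ → ℝ → ℝ}
    (hU : ∀ δ ∈ Ioo (0 : ℝ) (1 / 4), IsBump δ (U δ)) (hε : ε ∈ Ioo (0 : ℝ) 1) (hd : 2 ≤ d) :
    TendstoUniformly (fun δ => bifFamily d U ε δ) (linearExpanding d) (𝓝[>] (0 : ℝ)) := by
  have hd' : (2 : ℝ) ≤ d := by exact_mod_cast hd
  rw [Metric.tendstoUniformly_iff]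
  intro e he
  have hm : 0 < min (1 / 4) (e / d) := lt_min (by norm_num) (div_pos he (by linarith))
  filter_upwards [Ioo_mem_nhdsGT hm] with δ hδ x
  have hδ' : δ ∈ Ioo (0 : ℝ) (1 / 4) := ⟨hδ.1, hδ.2.trans_le (min_le_left _ _)⟩
  have hB := hU δ hδ'
  have hδe : d * δ < e := by
    have := hδ.2.trans_le (min_le_right _ _)
    rw [lt_div_iff₀ (by linarith)] at this
    linarith
  induction x using QuotientAddGroup.induction_on with | H t => ?_
  rw [(isC1Lift_linearExpanding d).2, (isC1Lift_bumpLift hδ' hB).2, dist_eq_norm,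
    ← AddCircle.coe_sub]
  refine QuotientAddGroup.norm_mk_le_norm.trans_lt ?_
  set s := t - round t with hs
  have h1 : d * t - bumpLift d ε (U δ) t = (d - ε) * (s * U δ s) := by rw [bumpLift]; ring
  have h2 : |s * U δ s| ≤ δ := by
    rcases le_total δ |s| with h | h
    · rw [hB.eq_zero s h, mul_zero, abs_zero]; exact hδ.1.le
    · have h3 := hB.mem_Icc hδ.1 s
      rw [abs_mul, abs_of_nonneg h3.1]
      exact (mul_le_of_le_one_right (abs_nonneg s) h3.2).trans h
  rw [h1, Real.norm_eq_abs, abs_mul, abs_of_nonneg (by linarith [hε.2] : 0 ≤ (d : ℝ) - ε)]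
  have h4 := mul_le_mul_of_nonneg_left h2 (by linarith [hε.2] : 0 ≤ (d : ℝ) - ε)
  have h5 := mul_pos hε.1 hδ.1
  linarith

end BumpLift

theorem mainTheorem5 (d : ℕ) (hd : 2 ≤ d) (U : ℝ → ℝ → ℝ)
    (hU : ∀ δ ∈ Ioo (0 : ℝ) (1 / 4), IsBump δ (U δ)) :
    (∀ ε ∈ Ioo (0 : ℝ) 1, ∀ δ ∈ Ioo (0 : ℝ) (1 / 4),
      IsNonsingularEndo d (bifFamily d U ε δ) ∧
      ((∀ x, U δ x = (d - 1) / (d - ε) → deriv (U δ) x ≠ 0) →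
        IsStructurallyStable (bifFamily d U ε δ) ∧
        IsHyperbolicAttracting (bifFamily d U ε δ) 1 0 ∧
        (∀ n x, IsHyperbolicAttracting (bifFamily d U ε δ) n x → x = 0) ∧
        ∃ C : Set UnitAddCircle, IsCantor C ∧ (0 : UnitAddCircle) ∉ C ∧
          nonWandering (bifFamily d U ε δ) = {0} ∪ C)) ∧
    (IsNonsingularEndo d (bifFamily d U 0 0) ∧
      IsStructurallyStable (bifFamily d U 0 0) ∧
      nonWandering (bifFamily d U 0 0) = univ) ∧
    (∀ ε ∈ Ioo (0 : ℝ) 1,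
      TendstoUniformly (fun δ => bifFamily d U ε δ) (linearExpanding d) (𝓝[>] (0 : ℝ))) := by
  refine ⟨fun ε hε δ hδ => ?_, ?_, fun ε hε => tendstoUniformly_bifFamily hU hε hd⟩
  · have hB := hU δ hδ
    have hlift := isC1Lift_bumpLift (d := d) (ε := ε) hδ hB
    refine ⟨isNonsingularEndo_of_lift (by omega) hlift bumpLift_add_one
      (deriv_bumpLift_pos hd hε hδ hB), fun hreg => ?_⟩
    obtain ⟨η, hη, hclose⟩ := exists_forall_close_bumpLift hd hε hδ hB hreg
    -- The lift is close to itself, so the perturbation statement also shows that it is a gap lift.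
    obtain ⟨κ, p, q, r, hq, hgap⟩ := hclose _ hlift.1 bumpLift_add_one
      (fun t => by simpa using hη)
    -- So far `q` is only known to lie on the plateau, where the lift is multiplication by `ε`, so
    -- its fixed point there is `0`.
    have hq0 : q = 0 := by
      have h1 := hgap.map_q
      rw [bumpLift_eq_of_abs_le hB hδ.2
        (abs_le.2 ⟨by linarith [hq.1, hδ.2], by linarith [hq.2, hδ.2]⟩), hB.eq_one q hq] at h1
      have h2 : (1 - ε) * q = 0 := by linarith
      exact (mul_eq_zero.1 h2).resolve_left (by linarith [hε.2])
    have hq0' : (q : UnitAddCircle) = 0 := by rw [hq0, AddCircle.coe_zero]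
    refine ⟨⟨⟨_, hlift⟩, min η (1 / 2), lt_min hη (by norm_num), fun g hg => ?_⟩,
      isHyperbolicAttracting_zero hε hδ hB,
      fun n x hx => (hgap.eq_of_isHyperbolicAttracting hlift.2 hx).trans hq0',
      avoidingSet (bifFamily d U ε δ) p r, hgap.isCantor_avoidingSet hd hlift.2,
      fun h0 => h0 0 (hq0' ▸ hgap.q_mem_gapArc), hq0' ▸ hgap.nonWandering_eq hd hlift.2⟩
    obtain ⟨G, hG, hGdeg, hFG⟩ := hg.exists_lift (min_le_right _ _) hlift bumpLift_add_one
    obtain ⟨κ', p', q', r', -, hgap'⟩ := hclose G hG.1 hGdeg fun t =>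
      ⟨(hFG t).1.trans_le (min_le_left _ _), (hFG t).2.trans_le (min_le_left _ _)⟩
    obtain ⟨Φ, hΦ⟩ := exists_orderIso_of_degree (d := d) (by omega) hgap.strictMono
      hgap.contDiff.continuous hgap.map_add_one
    obtain ⟨Γ, hΓ⟩ := exists_orderIso_of_degree (d := d) (by omega) hgap'.strictMono
      hgap'.contDiff.continuous hgap'.map_add_one
    rw [← hΦ] at hgap hlift
    rw [← hΓ] at hgap' hG
    exact exists_semiconj_of_lifts hlift.2 hG.2 (hgap.exists_conj hgap')
  · have h0 : bifFamily d U 0 0 = linearExpanding d := if_pos ⟨rfl, rfl⟩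
    rw [h0]
    exact ⟨isNonsingularEndo_linearExpanding (by omega), isStructurallyStable_linearExpanding hd,
      nonWandering_linearExpanding hd⟩
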